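/- Let $T:K\to K$ be a homeomorphism of a compact Hausdorff space, let $C(K)$ be the C*-algebra of continuous complex-valued functions on $K$, and let $\alpha_T(f)=f\circ T$ for $f\in C(K)$. A set $I\subseteq\mathbb{Z}$ is an *$\ell_1$-isomorphism set* for $f\in C(K)$ if there is a bijection from the standard basis of $\ell_1^I$ onto $\Delta=\{\alpha_T^i(f): i\in I\}$ that extends to a Banach space isomorphism (bounded linear, with bounded inverse) of $\ell_1^I$ onto $\overline{\operatorname{span}}\,\Delta$. The set $I$ has *positive density* if the limit $\lim_{n\to\infty}\frac{|I\cap\{-n,\dots,n\}|}{2n+1}$ exists and is positive. A *factor* of $(K,T)$ is a homeomorphism $S:L\to L$ of a compact Hausdorff space together with a continuous surjection $\pi:K\to L$ such that $\pi\circ T=S\circ\pi$; it is *nontrivial* if $L$ has more than one point; its algebra is $\{g\circ\pi : g\in C(L)\}\subseteq C(K)$. Then the following hold. 1. Among the factors of $(K,T)$ with zero topological entropy there is a largest one (the topological Pinsker factor), that is, one through which the factor map of every zero entropy factor of $(K,T)$ factors equivariantly. Its algebra, the topological Pinsker algebra $P_{K,T}$, is equal to the set of all $f\in C(K)$ which do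 not have an $\ell_1$-isomorphism set of positive density. 2. $T$ has positive topological entropy if and only if there is an $f\in C(K)$ with an $\ell_1$-isomorphism set of positive density. 3. $T$ has completely positive entropy (every nontrivial factor of $(K,T)$ has positive topological entropy) if and only if every nonconstant $f\in C(K)$ has an $\ell_1$-isomorphism set of positive density. -/

import Mathlib

open Set Filter Topology

universe u

namespace PinskerL1

noncomputable section

/-- `Δ` is equivalent to the standard basis of `ℓ₁^I`: some bijection from the standard basis
(indexed by `I`) onto `Δ` extends to an isomorphism of `ℓ₁^I` onto the closed span of `Δ`. -/
def EquivalentToL1Basis {X : Type*} [NormedAddCommGroup X] [NormedSpace ℂ X]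
    {ι : Type*} [DecidableEq ι] (Δ : Set X) : Prop :=
  ∃ (e : ι ≃ Δ)
    (γ : lp (fun _ : ι => ℂ) 1 ≃L[ℂ] (Submodule.span ℂ Δ).topologicalClosure),
    ∀ i : ι, (γ (lp.single 1 i (1 : ℂ)) : X) = (e i : X)

/-- `I ⊆ ℤ` is an `ℓ₁`-isomorphism set for `x` under the isometric automorphism `α`. -/
def IsL1IsomorphismSet {X : Type*} [NormedAddCommGroup X] [NormedSpace ℂ X]
    (α : X ≃ₗᵢ[ℂ] X) (x : X) (I : Set ℤ) : Prop :=
  EquivalentToL1Basis (ι := I) ((fun i : ℤ => (α ^ i) x) '' I)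

/-- `I ⊆ ℤ` has density `d`: the ratios `|I ∩ {-n, …, n}| / (2n+1)` converge to `d`. -/
def HasDensity (I : Set ℤ) (d : ℝ) : Prop :=
  Tendsto (fun n : ℕ => ((I ∩ Set.Icc (-(n : ℤ)) (n : ℤ)).ncard : ℝ) / (2 * (n : ℝ) + 1))
    atTop (𝓝 d)

/-- The isometric automorphism `f ↦ f ∘ T` of `C(K)` induced by a homeomorphism `T`. -/
def inducedAut {K : Type*} [TopologicalSpace K] [CompactSpace K] (T : K ≃ₜ K) :
    C(K, ℂ) ≃ₗᵢ[ℂ] C(K, ℂ) where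
  toFun f := f.comp (T : C(K, K))
  invFun f := f.comp (T.symm : C(K, K))
  left_inv f := by ext x; simp
  right_inv f := by ext x; simp
  map_add' f g := rfl
  map_smul' c f := rfl
  norm_map' f := by
    apply le_antisymm
    · exact (ContinuousMap.norm_le _ (norm_nonneg f)).2 fun x => f.norm_coe_le_norm (T x)
    · refine (ContinuousMap.norm_le _ (norm_nonneg _)).2 fun x => ?_
      have h := (f.comp (T : C(K, K))).norm_coe_le_norm (T.symm x)
      simpa using h

/-- `f ∈ C(K)` has an `ℓ₁`-isomorphism set of positive density (with respect to `f ↦ f ∘ T`). -/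
def HasPosDensityL1Set {K : Type*} [TopologicalSpace K] [CompactSpace K] (T : K ≃ₜ K)
    (f : C(K, ℂ)) : Prop :=
  ∃ I : Set ℤ, (∃ d : ℝ, 0 < d ∧ HasDensity I d) ∧ IsL1IsomorphismSet (inducedAut T) f I

/-- Topological entropy of a homeomorphism of a compact Hausdorff space, computed with the unique
compatible uniformity. It is nonnegative unless the space is empty, where it is `⊥`. -/
def topEntropy {K : Type*} [TopologicalSpace K] [CompactSpace K] [T2Space K] (T : K ≃ₜ K) :
    EReal :=
  letI : UniformSpace K := uniformSpaceOfCompactR1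
  Dynamics.coverEntropy T Set.univ

/-- A factor of `(K, T)`: a homeomorphism of a compact Hausdorff space together with an
equivariant continuous surjection from `K`. Every such space is homeomorphic to a quotient of `K`,
so nothing is lost by keeping it in the universe of `K`. -/
structure Factor {K : Type u} [TopologicalSpace K] (T : K ≃ₜ K) : Type (u + 1) where
  space : Type u
  [topologicalSpace : TopologicalSpace space]
  [compactSpace : CompactSpace space]
  [t2Space : T2Space space]
  homeo : space ≃ₜ space
  proj : C(K, space)
  surjective : Function.Surjective proj
  equivariant : ∀ x, proj (T x) = homeo (proj x)

attribute [instance] Factor.topologicalSpace Factor.compactSpace Factor.t2Space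

namespace Factor

variable {K : Type u} [TopologicalSpace K] {T : K ≃ₜ K}

/-- The topological entropy of a factor. -/
def entropy (F : Factor T) : EReal := topEntropy F.homeo

/-- Zero topological entropy; `≤` instead of `=` matters only for the empty space. -/
def HasZeroEntropy (F : Factor T) : Prop := F.entropy ≤ 0

/-- `F` is smaller than `G`: the factor map onto `F` factors through the factor map onto `G` by a
morphism of systems. -/
def IsBelow (F G : Factor T) : Prop :=
  ∃ ρ : C(G.space, F.space),
    (∀ y, ρ (G.homeo y) = F.homeo (ρ y)) ∧ ∀ x, ρ (G.proj x) = F.proj x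

/-- `F` is the topological Pinsker factor, i.e. the largest factor with zero entropy. -/
def IsPinsker (F : Factor T) : Prop :=
  F.HasZeroEntropy ∧ ∀ G : Factor T, G.HasZeroEntropy → G.IsBelow F

/-- The C*-subalgebra `{g ∘ π : g ∈ C(L)}` of `C(K)` corresponding to a factor `π : K → L`. -/
def algebra (F : Factor T) : StarSubalgebra ℂ C(K, ℂ) :=
  (ContinuousMap.compStarAlgHom' ℂ ℂ F.proj).range

end Factor

/-- Completely positive entropy: every nontrivial factor has positive topological entropy. -/
def HasCompletelyPositiveEntropy {K : Type u} [TopologicalSpace K] (T : K ≃ₜ K) : Prop :=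
  ∀ F : Factor T, Nontrivial F.space → 0 < F.entropy

end

end PinskerL1

/-!
The entropy of `T` can be seen through a single function `f` by counting orbit segments up to the
uniformity pulled back along `f`. A factor has zero entropy iff every function in its algebra has
zero entropy in this sense, so the functions of zero entropy generate the largest zero entropy
factor and form its algebra. What remains is that `f` has positive entropy iff it has an
`ℓ₁`-isomorphism set of positive density.

If `f` has positive entropy, there are exponentially many pairwise separated orbit segments of
length `n`. Rounding the values of `f` to a grid and applying the Sauer–Shelah lemma gives a set of
times of cardinality proportional to `n` along which `f` runs independently through two separated
regions of `ℂ`; there the translates of `f` dominate an `ℓ₁`-norm. Shifting each such set to start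
where its count lags furthest behind the expected proportion makes all initial segments dense, and a
limit along an ultrafilter is then a single set with a density.

Conversely, an `ℓ₁`-lower bound over `d` times makes every signed sum of the corresponding
translates of size at least `κ d` somewhere on `K`. A fixed point of `K` can do this only for an
exponentially small fraction of the `2 ^ d` choices of signs, by the subgaussian bound for random
signs, so exponentially many orbit segments are needed.
-/

namespace PinskerL1

section Combinatorics

theorem exists_sum_prod_le_card {ι X B : Type*} [Fintype ι] [Fintype B] [Nonempty B]
    (F : Finset X) (R : ι → X → B → Prop) [∀ i x b, Decidable (R i x b)] :
    ∃ j : ι → B, ∑ x ∈ F, ∏ i, ((Finset.univ.filter (R i x)).card / Fintype.card B : ℝ) ≤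
      (F.filter fun x => ∀ i, R i x (j i)).card := by
  classical
  have double_count : ∑ j : ι → B, (F.filter fun x => ∀ i, R i x (j i)).card =
      ∑ x ∈ F, ∏ i, (Finset.univ.filter (R i x)).card := by
    simp only [Finset.card_filter _ F]
    rw [Finset.sum_comm]
    refine Finset.sum_congr rfl fun x _ => ?_
    rw [← Fintype.card_piFinset, ← Finset.card_filter]
    congr 1
    ext j
    simp
  obtain ⟨j, -, hj⟩ := Finset.exists_le_of_sum_le (s := (Finset.univ : Finset (ι → B)))
    (f := fun _ => ∑ x ∈ F, ∏ i, ((Finset.univ.filter (R i x)).card / Fintype.card B : ℝ))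
    (g := fun j => ((F.filter fun x => ∀ i, R i x (j i)).card : ℝ)) Finset.univ_nonempty
    (by
      rw [← Nat.cast_sum, double_count, Finset.sum_const, Finset.card_univ, Fintype.card_fun,
        nsmul_eq_mul, Finset.mul_sum]
      push_cast
      refine Finset.sum_le_sum fun x _ => ?_
      rw [Finset.prod_div_distrib, Finset.prod_const, Finset.card_univ, mul_div_cancel₀]
      positivity)
  exact ⟨j, hj⟩

theorem sum_pow_card_le_exp {ι : Type*} {S : Finset ι} {𝒜 : Finset (Finset ι)}
    (h : 𝒜 ⊆ S.powerset) {x : ℝ} (hx : 0 ≤ x) :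
    ∑ U ∈ 𝒜, x ^ U.card ≤ Real.exp (x * S.card) :=
  calc ∑ U ∈ 𝒜, x ^ U.card ≤ ∑ U ∈ S.powerset, x ^ U.card :=
        Finset.sum_le_sum_of_subset_of_nonneg h fun _ _ _ => by positivity
    _ = (x + 1) ^ S.card := by simpa using Finset.sum_pow_mul_eq_add_pow x 1 S
    _ ≤ Real.exp (x * S.card) := by
        rw [mul_comm, Real.exp_nat_mul]
        exact pow_le_pow_left₀ (by positivity) (Real.add_one_le_exp x) _

theorem exists_shatters_of_exp_le_card {c : ℝ} (hc : 0 < c) :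
    ∃ κ : ℝ, 0 < κ ∧ ∀ {ι : Type*} [DecidableEq ι] {S : Finset ι} {𝒜 : Finset (Finset ι)},
      𝒜 ⊆ S.powerset → Real.exp (c * S.card) ≤ 𝒜.card →
        ∃ U ⊆ S, 𝒜.Shatters U ∧ κ * S.card ≤ U.card := by
  set x : ℝ := min c 1 / 2 with hx
  have x_pos : 0 < x := by positivity
  have x_lt_c : x < c := by linarith [min_le_left c 1]
  have x_lt_one : x < 1 := by linarith [min_le_right c 1]
  have log_neg : Real.log x < 0 := Real.log_neg x_pos x_lt_one
  refine ⟨(c - x) / -Real.log x, div_pos (by linarith) (by linarith), ?_⟩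
  intro ι _ S 𝒜 h𝒜 hcard
  by_contra! small
  have shattered_subset : 𝒜.shatterer ⊆ S.powerset := fun U hU => by
    obtain ⟨V, hV, hUV⟩ := (Finset.mem_shatterer.1 hU).exists_superset
    exact Finset.mem_powerset.2 (hUV.trans (Finset.mem_powerset.1 (h𝒜 hV)))
  have shatterer_large : Real.exp (c * S.card) ≤ 𝒜.shatterer.card :=
    hcard.trans (by exact_mod_cast Finset.card_le_card_shatterer 𝒜)
  have nonempty : 𝒜.shatterer.Nonempty := by
    rw [← Finset.card_pos]
    exact_mod_cast (Real.exp_pos _).trans_le shatterer_large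
  have : Real.exp (x * S.card) < Real.exp (x * S.card) :=
    calc Real.exp (x * S.card)
        = Real.exp (c * S.card) * x ^ ((c - x) / -Real.log x * S.card) := by
          rw [Real.rpow_def_of_pos x_pos, ← Real.exp_add]
          congr 1
          field_simp [log_neg.ne]
          ring
      _ ≤ ∑ _U ∈ 𝒜.shatterer, x ^ ((c - x) / -Real.log x * S.card) := by
          rw [Finset.sum_const, nsmul_eq_mul]
          gcongr
      _ < ∑ U ∈ 𝒜.shatterer, x ^ U.card := by
          refine Finset.sum_lt_sum_of_nonempty nonempty fun U hU => ?_
          rw [← Real.rpow_natCast]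
          exact Real.rpow_lt_rpow_of_exponent_gt x_pos x_lt_one
            (small U (Finset.mem_powerset.1 (shattered_subset hU)) (Finset.mem_shatterer.1 hU))
      _ ≤ Real.exp (x * S.card) := sum_pow_card_le_exp shattered_subset x_pos.le
  exact this.false

/-- The pairs `(P i, Q i)`, `i ∈ S`, are independent: every choice of one member from each pair is
realized by a point. -/
def IsIndependent {ι X : Type*} (P Q : ι → Set X) (S : Finset ι) : Prop :=
  ∀ t ⊆ S, ∃ x, ∀ i ∈ S, (i ∈ t → x ∈ P i) ∧ (i ∉ t → x ∈ Q i)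

theorem IsIndependent.symm {ι X : Type*} {P Q : ι → Set X} {S : Finset ι}
    (h : IsIndependent P Q S) : IsIndependent Q P S := by
  classical
  intro t _
  obtain ⟨x, hx⟩ := h (S \ t) Finset.sdiff_subset
  refine ⟨x, fun i hi => ⟨fun hit => (hx i hi).2 ?_, fun hit => (hx i hi).1 ?_⟩⟩ <;> simp [hi, hit]

theorem IsIndependent.mono {ι X : Type*} {P Q P' Q' : ι → Set X} {S : Finset ι}
    (h : IsIndependent P Q S) (hP : ∀ i, P i ⊆ P' i) (hQ : ∀ i, Q i ⊆ Q' i) :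
    IsIndependent P' Q' S := fun t ht => by
  obtain ⟨x, hx⟩ := h t ht
  exact ⟨x, fun i hi => ⟨fun hit => hP i ((hx i hi).1 hit), fun hit => hQ i ((hx i hi).2 hit)⟩⟩

theorem IsIndependent.nonempty {ι X : Type*} {P Q : ι → Set X} {S : Finset ι}
    (h : IsIndependent P Q S) {i : ι} (hi : i ∈ S) : (P i).Nonempty ∧ (Q i).Nonempty := by
  obtain ⟨x, hx⟩ := h S subset_rfl
  obtain ⟨y, hy⟩ := h ∅ (Finset.empty_subset S)
  exact ⟨⟨x, (hx i hi).1 hi⟩, ⟨y, (hy i hi).2 (Finset.notMem_empty i)⟩⟩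

theorem exists_isIndependent_of_injOn {c : ℝ} (hc : 0 < c) (C : Type*) [Finite C] :
    ∃ κ : ℝ, 0 < κ ∧ ∀ {ι X : Type*} [Fintype ι] (w : X → ι → C) (E : Finset X),
      InjOn w E → Real.exp (c * Fintype.card ι) ≤ E.card →
        ∃ (S : Finset ι) (a : ι → C), κ * Fintype.card ι ≤ S.card ∧
          IsIndependent (fun i => {x ∈ E | w x i = a i}) (fun i => {x ∈ E | w x i ≠ a i}) S := by
  classical
  have := Fintype.ofFinite C
  obtain ⟨κ, κ_pos, hκ⟩ := exists_shatters_of_exp_le_card (c := c / (Fintype.card C + 1))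
    (by positivity)
  refine ⟨κ, κ_pos, fun {ι X} _ w E hw hE => ?_⟩
  -- A shattered set of pairs lies in the graph of one of the words, hence over each coordinate it
  -- contains at most one letter.
  let graph : X → Finset (ι × C) := fun x => Finset.univ.filter fun p => w x p.1 = p.2
  have graph_injOn : InjOn graph E := fun x hx y hy hxy => hw hx hy <| funext fun i => by
    have : (i, w x i) ∈ graph y := hxy ▸ by simp [graph]
    simpa [graph, eq_comm] using this
  obtain ⟨U, -, hU, U_card⟩ := hκ (S := Finset.univ) (𝒜 := E.image graph)
    (by simp) (by
      rw [Finset.card_image_of_injOn graph_injOn, Finset.card_univ, Fintype.card_prod]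
      refine le_trans (Real.exp_le_exp.2 ?_) hE
      push_cast
      rw [div_mul_eq_mul_div, div_le_iff₀ (by positivity)]
      nlinarith [mul_nonneg hc.le (Nat.cast_nonneg (α := ℝ) (Fintype.card ι))])
  have mem_iff : ∀ V ⊆ U, ∃ x ∈ E, ∀ p ∈ U, p ∈ V ↔ w x p.1 = p.2 := fun V hV => by
    obtain ⟨_, hx, hxV⟩ := hU hV
    obtain ⟨x, hxE, rfl⟩ := Finset.mem_image.1 hx
    exact ⟨x, hxE, fun p hp => by simp [← hxV, hp, graph]⟩
  obtain ⟨x₀, -, hx₀⟩ := mem_iff U subset_rfl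
  have eq_of_mem : ∀ p ∈ U, p.2 = w x₀ p.1 := fun p hp => ((hx₀ p hp).1 hp).symm
  have fst_injOn : InjOn Prod.fst (U : Set (ι × C)) := fun p hp q hq hpq =>
    Prod.ext hpq (by rw [eq_of_mem p hp, eq_of_mem q hq, hpq])
  refine ⟨U.image Prod.fst, w x₀, ?_, fun t _ => ?_⟩
  · rw [Finset.card_image_of_injOn fst_injOn]
    refine le_trans ?_ U_card
    have := Fintype.card_le_of_injective (fun i => (i, w x₀ i)) fun i k h => congrArg Prod.fst h
    rw [Finset.card_univ]
    gcongr
  · obtain ⟨x, hxE, hx⟩ := mem_iff (U.filter fun p => p.1 ∈ t) (Finset.filter_subset _ _)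
    refine ⟨x, fun i hi => ?_⟩
    obtain ⟨p, hp, rfl⟩ := Finset.mem_image.1 hi
    have := hx p hp
    simp only [Finset.mem_filter, hp, true_and] at this
    simp [hxE, this, eq_of_mem p hp]

theorem two_le_abs_sub_of_ediv_ne {m k l : ℤ} (hm : 0 < m) (hk : ¬ m ∣ k) (hl : ¬ m ∣ l)
    (h : k / m ≠ l / m) : 2 ≤ |k - l| := by
  wlog hlt : k / m < l / m generalizing k l
  · rw [abs_sub_comm]
    exact this hl hk h.symm (lt_of_le_of_ne (not_lt.1 hlt) h.symm)
  have hk_lt := Int.lt_ediv_add_one_mul_self k hm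
  have hl_lt : l / m * m < l :=
    lt_of_le_of_ne (Int.ediv_mul_le l hm.ne') fun h => hl ⟨l / m, by rw [mul_comm, h]⟩
  have : (k / m + 1) * m ≤ l / m * m := by gcongr; omega
  rw [abs_sub_comm]
  exact le_trans (by omega) (le_abs_self _)

theorem ediv_ne_of_le_abs_sub {m k l : ℤ} (hm : 0 < m) (h : m ≤ |k - l|) : k / m ≠ l / m := by
  intro heq
  have := Int.emod_lt_of_pos k hm
  have := Int.emod_lt_of_pos l hm
  have := Int.emod_nonneg k hm.ne'
  have := Int.emod_nonneg l hm.ne'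
  have hk := Int.emod_add_mul_ediv k m
  have hl := Int.emod_add_mul_ediv l m
  rw [heq] at hk
  rcases abs_cases (k - l) with h' | h' <;> omega

theorem exists_offsets_not_dvd {ι X : Type*} [Fintype ι] (m : ℕ) [NeZero m] (u : ι → X → ℤ)
    (E : Finset X) :
    ∃ j : ι → ZMod m, (1 - 1 / m : ℝ) ^ Fintype.card ι * E.card ≤
      (E.filter fun x => ∀ i, ¬ (m : ℤ) ∣ u i x - (j i).val).card := by
  classical
  obtain ⟨j, hj⟩ := exists_sum_prod_le_card E fun i x (b : ZMod m) => ((u i x : ℤ) : ZMod m) ≠ b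
  refine ⟨j, le_trans (le_of_eq ?_) (hj.trans_eq ?_)⟩
  · have hm : (m : ℝ) ≠ 0 := NeZero.ne _
    simp only [Finset.filter_ne, Finset.card_erase_of_mem (Finset.mem_univ _), Finset.card_univ,
      ZMod.card, Nat.cast_pred (NeZero.pos m), Finset.prod_const, Finset.sum_const, nsmul_eq_mul]
    rw [mul_comm, sub_div, div_self hm]
  · simp only [← ZMod.intCast_zmod_eq_zero_iff_dvd, Int.cast_sub, Int.cast_natCast,
      ZMod.natCast_zmod_val, sub_eq_zero, ne_eq]

theorem exists_isIndependent_of_forall_exists_le_abs_sub {c : ℝ} (hc : 0 < c) {m : ℕ} [NeZero m]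
    (hm : Real.exp (-c) ≤ 1 - 1 / m) (D : Set ℤ) [Finite D] :
    ∃ κ : ℝ, 0 < κ ∧ ∀ {ι X : Type*} [Fintype ι] (u : ι → X → D) (E : Finset X),
      (∀ x ∈ E, ∀ y ∈ E, x ≠ y → ∃ i, (m : ℤ) ≤ |(u i x : ℤ) - u i y|) →
      Real.exp (2 * c * Fintype.card ι) ≤ E.card →
        ∃ (S : Finset ι) (P Q : ι → Set X), κ * Fintype.card ι ≤ S.card ∧
          IsIndependent P Q S ∧ ∀ i, ∀ x ∈ P i, ∀ y ∈ Q i, 2 ≤ |(u i x : ℤ) - u i y| := by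
  classical
  have m_pos : (0 : ℤ) < m := by exact_mod_cast NeZero.pos m
  -- After deleting the points with a coordinate divisible by `m`, different levels are two apart.
  let level : D × ZMod m → ℤ := fun p => ((p.1 : ℤ) - p.2.val) / m
  obtain ⟨κ, κ_pos, hκ⟩ := exists_isIndependent_of_injOn hc (range level)
  refine ⟨κ, κ_pos, fun {ι X} _ u E hE hcard => ?_⟩
  obtain ⟨j, hj⟩ := exists_offsets_not_dvd m (fun i x => (u i x : ℤ)) E
  set E' := E.filter fun x => ∀ i, ¬ (m : ℤ) ∣ u i x - (j i).val
  let w : X → ι → range level := fun x i => ⟨level (u i x, j i), mem_range_self _⟩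
  have w_injOn : InjOn w E' := fun x hx y hy hxy => by
    by_contra hne
    obtain ⟨i, hi⟩ := hE x (Finset.mem_filter.1 hx).1 y (Finset.mem_filter.1 hy).1 hne
    exact ediv_ne_of_le_abs_sub m_pos (by rwa [sub_sub_sub_cancel_right])
      (congrArg Subtype.val (congrFun hxy i))
  have ratio_nonneg : 0 ≤ 1 - 1 / (m : ℝ) := (Real.exp_pos _).le.trans hm
  have E'_card : Real.exp (c * Fintype.card ι) ≤ E'.card :=
    calc Real.exp (c * Fintype.card ι)
        = Real.exp (-c) ^ Fintype.card ι * Real.exp (2 * c * Fintype.card ι) := by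
          rw [← Real.exp_nat_mul, ← Real.exp_add]
          ring_nf
      _ ≤ (1 - 1 / m) ^ Fintype.card ι * E.card := by gcongr
      _ ≤ E'.card := hj
  obtain ⟨S, a, S_card, hS⟩ := hκ w E' w_injOn E'_card
  refine ⟨S, _, _, S_card, hS, fun i x hx y hy => ?_⟩
  have := two_le_abs_sub_of_ediv_ne m_pos ((Finset.mem_filter.1 hx.1).2 i)
    ((Finset.mem_filter.1 hy.1).2 i) fun h => hy.2 (Subtype.ext (h.symm.trans
      (congrArg Subtype.val hx.2)))
  rwa [sub_sub_sub_cancel_right] at this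

theorem exists_isIndependent_inter_left (A : Type*) [Finite A] [Nonempty A] :
    ∃ κ : ℝ, 0 < κ ∧ ∀ {ι X : Type*} [Finite ι] {P Q : ι → Set X} {S : Finset ι},
      IsIndependent P Q S → ∀ col : ι → X → A, ∃ S' ⊆ S, κ * S.card ≤ S'.card ∧
        ∃ a : ι → A, IsIndependent (fun i => P i ∩ {x | col i x = a i}) Q S' := by
  classical
  have := Fintype.ofFinite A
  set N : ℝ := (Fintype.card A : ℝ)
  have N_pos : 0 < N := Nat.cast_pos.2 Fintype.card_pos
  obtain ⟨κ, κ_pos, hκ⟩ := exists_shatters_of_exp_le_card (c := Real.log (1 + N⁻¹))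
    (Real.log_pos (by linarith [inv_pos.2 N_pos]))
  refine ⟨κ, κ_pos, fun {ι X} _ P Q S hS col => ?_⟩
  have := Fintype.ofFinite ι
  have : Nonempty X := (hS S subset_rfl).nonempty
  choose! x hx using hS
  obtain ⟨a, ha⟩ := exists_sum_prod_le_card S.powerset fun i t b => i ∈ t → col i (x t) = b
  set 𝒜 := S.powerset.filter fun t => ∀ i, i ∈ t → col i (x t) = a i
  have weight (t : Finset ι) :
      ∏ i, ((Finset.univ.filter fun b => i ∈ t → col i (x t) = b).card / N) = N⁻¹ ^ t.card := by
    rw [← Finset.prod_const, ← Finset.prod_subset t.subset_univ]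
    · refine Finset.prod_congr rfl fun i hi => ?_
      simp [hi, Finset.filter_eq]
    · intro i _ hi
      simp [hi, N]
  have 𝒜_card : Real.exp (Real.log (1 + N⁻¹) * S.card) ≤ 𝒜.card := by
    refine le_trans (le_of_eq ?_) ha
    rw [mul_comm, Real.exp_nat_mul, Real.exp_log (by positivity),
      Finset.sum_congr rfl fun t _ => weight t]
    simpa [add_comm] using (Finset.sum_pow_mul_eq_add_pow N⁻¹ 1 S).symm
  obtain ⟨S', S'_subset, hS', S'_card⟩ := hκ (Finset.filter_subset _ _) 𝒜_card
  refine ⟨S', S'_subset, S'_card, a, fun t ht => ?_⟩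
  obtain ⟨V, hV, rfl⟩ := hS' ht
  obtain ⟨hVS, hVa⟩ := Finset.mem_filter.1 hV
  refine ⟨x V, fun i hi => ?_⟩
  have := hx V (Finset.mem_powerset.1 hVS) i (S'_subset hi)
  simp only [Finset.mem_inter, hi, true_and]
  exact ⟨fun hiV => ⟨this.1 hiV, hVa i hiV⟩, this.2⟩

theorem IsIndependent.exists_inter (A : Type*) [Finite A] [Nonempty A] :
    ∃ κ : ℝ, 0 < κ ∧ ∀ {ι X : Type*} [Finite ι] {P Q : ι → Set X} {S : Finset ι},
      IsIndependent P Q S → ∀ col : ι → X → A, ∃ S' ⊆ S, κ * S.card ≤ S'.card ∧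
        ∃ a b : ι → A, IsIndependent (fun i => P i ∩ {x | col i x = a i})
          (fun i => Q i ∩ {x | col i x = b i}) S' := by
  obtain ⟨κ, κ_pos, hκ⟩ := exists_isIndependent_inter_left A
  refine ⟨κ * κ, by positivity, fun {ι X} _ P Q S hS col => ?_⟩
  obtain ⟨S₁, S₁_subset, S₁_card, a, ha⟩ := hκ hS col
  obtain ⟨S₂, S₂_subset, S₂_card, b, hb⟩ := hκ ha.symm col
  refine ⟨S₂, S₂_subset.trans S₁_subset, le_trans ?_ S₂_card, a, b, hb.symm⟩
  rw [mul_assoc]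
  gcongr

theorem exists_half_sum_norm_le_sum_abs_re {ι : Type*} (S : Finset ι) (z : ι → ℂ) :
    ∃ ω : ℂ, ‖ω‖ = 1 ∧ (∑ i ∈ S, ‖z i‖) / 2 ≤ ∑ i ∈ S, |(ω * z i).re| := by
  have sum_norm_le : ∑ i ∈ S, ‖z i‖ ≤ ∑ i ∈ S, |(z i).re| + ∑ i ∈ S, |(z i).im| := by
    rw [← Finset.sum_add_distrib]
    exact Finset.sum_le_sum fun i _ => Complex.norm_le_abs_re_add_abs_im (z i)
  rcases le_total (∑ i ∈ S, |(z i).im|) (∑ i ∈ S, |(z i).re|) with h | h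
  · exact ⟨1, by simp, by simpa using by linarith⟩
  · exact ⟨Complex.I, by simp, by simpa using by linarith⟩

theorem abs_re_mul_sub_le_re_mul {w z d : ℂ} {δ : ℝ} (hz : ‖z - d‖ ≤ δ) (hd : 0 ≤ (w * d).re) :
    |(w * d).re| - δ * ‖w‖ ≤ (w * z).re := by
  have error_le : |(w * (z - d)).re| ≤ δ * ‖w‖ := by
    refine (Complex.abs_re_le_norm _).trans ?_
    rw [norm_mul, mul_comm]
    gcongr
  rw [mul_sub, Complex.sub_re] at error_le
  rw [abs_of_nonneg hd]
  linarith [(abs_le.1 error_le).1]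

theorem IsIndependent.mul_sum_norm_le {ι X : Type*} {P Q : ι → Set X} {S : Finset ι}
    (hS : IsIndependent P Q S) {f : ι → X → ℂ} {d : ι → ℂ} {η δ : ℝ}
    (hd : ∀ i ∈ S, η ≤ ‖d i‖)
    (hf : ∀ i ∈ S, ∀ x ∈ P i, ∀ y ∈ Q i, ‖f i x - f i y - d i‖ ≤ δ) (c : ι → ℂ) {B : ℝ}
    (hB : ∀ x, ‖∑ i ∈ S, c i * f i x‖ ≤ B) :
    (η / 4 - δ / 2) * ∑ i ∈ S, ‖c i‖ ≤ B := by
  classical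
  obtain ⟨ω, ω_norm, hω⟩ := exists_half_sum_norm_le_sum_abs_re S fun i => c i * d i
  set t := S.filter fun i => 0 ≤ (ω * (c i * d i)).re
  obtain ⟨x, hx⟩ := hS t (Finset.filter_subset _ _)
  obtain ⟨y, hy⟩ := hS.symm t (Finset.filter_subset _ _)
  have term_le : ∀ i ∈ S, |(ω * (c i * d i)).re| - δ * ‖c i‖ ≤
      (ω * (c i * (f i x - f i y))).re := fun i hi => by
    have norm_coeff : ‖ω * c i‖ = ‖c i‖ := by rw [norm_mul, ω_norm, one_mul]
    rw [← norm_coeff, ← mul_assoc, ← mul_assoc]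
    by_cases hit : i ∈ t
    · refine abs_re_mul_sub_le_re_mul (hf i hi x ((hx i hi).1 hit) y ((hy i hi).1 hit)) ?_
      rw [mul_assoc]
      exact (Finset.mem_filter.1 hit).2
    · have neg : (ω * (c i * d i)).re < 0 := not_le.1 fun h => hit (Finset.mem_filter.2 ⟨hi, h⟩)
      have := abs_re_mul_sub_le_re_mul (w := -(ω * c i))
        (hf i hi y ((hy i hi).2 hit) x ((hx i hi).2 hit))
        (by rw [neg_mul, mul_assoc, Complex.neg_re]; exact (neg_pos.2 neg).le)
      rwa [neg_mul, Complex.neg_re, abs_neg, norm_neg, neg_mul, ← mul_neg, neg_sub] at this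
  have sum_le : ∑ i ∈ S, (ω * (c i * (f i x - f i y))).re ≤ 2 * B := by
    rw [← Complex.re_sum, ← Finset.mul_sum]
    refine (Complex.re_le_norm _).trans ?_
    rw [norm_mul, ω_norm, one_mul]
    simp only [mul_sub, Finset.sum_sub_distrib]
    exact (norm_sub_le _ _).trans (by linarith [hB x, hB y])
  have sum_norm_ge : η * ∑ i ∈ S, ‖c i‖ ≤ ∑ i ∈ S, ‖c i * d i‖ := by
    rw [Finset.mul_sum]
    refine Finset.sum_le_sum fun i hi => ?_
    rw [norm_mul, mul_comm]
    gcongr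
    exact hd i hi
  have := (Finset.sum_le_sum term_le).trans sum_le
  rw [Finset.sum_sub_distrib, ← Finset.mul_sum] at this
  linarith

end Combinatorics

section Density

open scoped Classical in
theorem exists_forall_mul_le_count_add {J : Set ℕ} {ε : ℝ} {m N : ℕ}
    (h : m + ε * N ≤ Nat.count (· ∈ J) N) :
    ∃ p, ∀ n ≤ m, ε * n ≤ Nat.count (fun k => p + k ∈ J) n := by
  rcases lt_or_ge ε 0 with hε | hε
  · exact ⟨0, fun n _ => (mul_nonpos_of_nonpos_of_nonneg hε.le n.cast_nonneg).trans
      (Nat.cast_nonneg _)⟩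
  obtain ⟨p, hpN, p_min⟩ := Finset.exists_min_image (Finset.range (N + 1))
    (fun k => (Nat.count (· ∈ J) k : ℝ) - ε * k) ⟨0, by simp⟩
  have split (k : ℕ) : (Nat.count (· ∈ J) (p + k) : ℝ) =
      Nat.count (· ∈ J) p + Nat.count (fun k => p + k ∈ J) k := by
    rw [Nat.count_add, Nat.cast_add]
  obtain ⟨l, rfl⟩ := Nat.exists_eq_add_of_le (Finset.mem_range_succ_iff.1 hpN)
  have m_le_l : m ≤ l := by
    have at_zero := p_min 0 (by simp)
    have count_le : (Nat.count (fun k => p + k ∈ J) l : ℝ) ≤ l := by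
      exact_mod_cast Nat.count_le _
    have := split l
    have := mul_nonneg hε l.cast_nonneg
    simp only [Nat.count_zero, Nat.cast_zero, mul_zero, sub_zero] at at_zero
    push_cast at h
    exact_mod_cast (by linarith : (m : ℝ) ≤ l)
  refine ⟨p, fun n hn => ?_⟩
  have := p_min (p + n) (by simp; omega)
  have := split n
  push_cast at *
  linarith

/-- The largest number of elements below `n` of a set with the property `P`. -/
noncomputable def maxCount (P : Set ℕ → Prop) (n : ℕ) : ℕ :=
  open scoped Classical in sSup {c | ∃ J, P J ∧ Nat.count (· ∈ J) n = c}

variable {P : Set ℕ → Prop}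

theorem count_le_maxCount {J : Set ℕ} [DecidablePred (· ∈ J)] (hJ : P J) (n : ℕ) :
    Nat.count (· ∈ J) n ≤ maxCount P n := by
  classical
  exact le_csSup ⟨n, by rintro _ ⟨J, -, rfl⟩; exact Nat.count_le _⟩
    ⟨J, hJ, by congr!⟩

open scoped Classical in
theorem exists_count_eq_maxCount (hP : ∃ J, P J) (n : ℕ) :
    ∃ J, P J ∧ Nat.count (· ∈ J) n = maxCount P n := by
  obtain ⟨J, hJ⟩ := hP
  exact Nat.sSup_mem (s := {c | ∃ J, P J ∧ Nat.count (· ∈ J) n = c}) ⟨_, J, hJ, rfl⟩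
    ⟨n, by rintro _ ⟨J, -, rfl⟩; exact Nat.count_le _⟩

theorem subadditive_maxCount (hP : ∃ J, P J) (hshift : ∀ J k, P J → P {i | k + i ∈ J}) :
    Subadditive fun n => (maxCount P n : ℝ) := by
  classical
  intro m n
  obtain ⟨J, hJ, hcount⟩ := exists_count_eq_maxCount hP (m + n)
  simp only [← hcount, Nat.count_add]
  exact_mod_cast add_le_add (count_le_maxCount hJ m) (count_le_maxCount (hshift J m hJ) n)

open scoped Classical in
theorem exists_forall_mul_le_count (hP : ∃ J, P J) (hshift : ∀ J k, P J → P {i | k + i ∈ J})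
    {d : ℝ} (hd : ∀ n : ℕ, d * n ≤ maxCount P n) (m : ℕ) :
    ∃ J, P J ∧ ∀ n ≤ m, (d - 1 / m) * n ≤ Nat.count (· ∈ J) n := by
  rcases m.eq_zero_or_pos with rfl | hm
  · obtain ⟨J, hJ⟩ := hP
    exact ⟨J, hJ, fun n hn => by simp [Nat.le_zero.1 hn]⟩
  obtain ⟨J, hJ, hcount⟩ := exists_count_eq_maxCount hP (m * m)
  obtain ⟨p, hp⟩ := exists_forall_mul_le_count_add (J := J) (ε := d - 1 / m) (m := m) (N := m * m)
    (by
      rw [hcount]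
      refine le_trans (le_of_eq ?_) (hd (m * m))
      push_cast
      field_simp
      ring)
  exact ⟨_, hshift J p hJ, hp⟩

open scoped Classical in
theorem exists_forall_finite_subset_and_mul_le_count (hmono : ∀ J J', J ⊆ J' → P J' → P J)
    {d : ℝ} (hd : ∀ m : ℕ, ∃ J, P J ∧ ∀ n ≤ m, (d - 1 / m) * n ≤ Nat.count (· ∈ J) n) :
    ∃ I : Set ℕ, (∀ A ⊆ I, A.Finite → P A) ∧ ∀ n : ℕ, d * n ≤ Nat.count (· ∈ I) n := by
  choose J hJ J_count using hd
  let 𝒰 : Ultrafilter ℕ := hyperfilter ℕ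
  have 𝒰_le : (𝒰 : Filter ℕ) ≤ atTop := Nat.hyperfilter_le_atTop
  let I : Set ℕ := {i | ∀ᶠ m in 𝒰, i ∈ J m}
  refine ⟨I, fun A hA hfin => ?_, fun n => ?_⟩
  · obtain ⟨m, hm⟩ := ((Set.Finite.eventually_all hfin).2 hA).exists
    exact hmono A (J m) hm (hJ m)
  · have agree : ∀ᶠ m in (𝒰 : Filter ℕ), ∀ i ∈ Finset.range n, i ∈ J m ↔ i ∈ I :=
      (Filter.eventually_all_finset _).2 fun i _ => by
        by_cases hi : i ∈ I
        · exact Eventually.mono hi fun m hm => by simp [hm, hi]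
        · exact (Ultrafilter.eventually_not.2 hi).mono fun m hm => by simp [hm, hi]
    have lower : ∀ᶠ m : ℕ in (𝒰 : Filter ℕ), (d - 1 / m) * n ≤ Nat.count (· ∈ I) n := by
      filter_upwards [agree, 𝒰_le (eventually_ge_atTop n)] with m hm hnm
      rw [Nat.count_eq_card_filter_range, ← Finset.filter_congr hm,
        ← Nat.count_eq_card_filter_range]
      exact J_count m n hnm
    have limit : Tendsto (fun m : ℕ => (d - 1 / (m : ℝ)) * n) 𝒰 (𝓝 (d * n)) := by
      have := ((tendsto_one_div_atTop_nhds_zero_nat (𝕜 := ℝ)).const_sub d).mul_const (n : ℝ)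
      rw [sub_zero] at this
      exact this.mono_left 𝒰_le
    exact le_of_tendsto limit lower

open scoped Classical in
theorem hasDensity_image_natCast {I : Set ℕ} {d : ℝ}
    (h : Tendsto (fun n : ℕ => (Nat.count (· ∈ I) n : ℝ) / n) atTop (𝓝 d)) :
    HasDensity ((↑) '' I : Set ℤ) (d / 2) := by
  have ncard_eq (n : ℕ) : (((↑) '' I : Set ℤ) ∩ Set.Icc (-(n : ℤ)) n).ncard =
      Nat.count (· ∈ I) (n + 1) := by
    have : ((↑) '' I : Set ℤ) ∩ Set.Icc (-(n : ℤ)) n =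
        ((↑) : ℕ → ℤ) '' ((Finset.range (n + 1)).filter (· ∈ I)) := by
      ext i
      simp only [mem_inter_iff, mem_image, mem_Icc, Finset.coe_filter, Finset.mem_range,
        mem_ofPred_eq]
      constructor
      · rintro ⟨⟨k, hk, rfl⟩, -, hkn⟩
        exact ⟨k, ⟨by omega, hk⟩, rfl⟩
      · rintro ⟨k, ⟨hkn, hk⟩, rfl⟩
        exact ⟨⟨k, hk, rfl⟩, by omega, by omega⟩
    rw [this, Set.ncard_image_of_injective _ Nat.cast_injective, Set.ncard_coe_finset,
      Nat.count_eq_card_filter_range]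
  have half : Tendsto (fun n : ℕ => ((n : ℝ) + 1) / (2 * n + 1)) atTop (𝓝 (1 / 2)) := by
    simpa [add_comm] using tendsto_add_mul_div_add_mul_atTop_nhds (𝕜 := ℝ) 1 1 1 two_ne_zero
  have := (h.comp (tendsto_add_atTop_nat 1)).mul half
  rw [mul_one_div] at this
  refine this.congr fun n => ?_
  simp only [Function.comp_apply, ncard_eq]
  push_cast
  field_simp

theorem exists_hasDensity (hmono : ∀ J J', J ⊆ J' → P J' → P J)
    (hshift : ∀ J k, P J → P {i | k + i ∈ J}) {κ : ℝ} (hκ : 0 < κ)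
    (hP : ∃ᶠ n : ℕ in atTop, ∃ A ⊆ Finset.range n, P A ∧ κ * n ≤ A.card) :
    ∃ I : Set ℕ, (∀ A ⊆ I, A.Finite → P A) ∧ ∃ d, 0 < d ∧ HasDensity ((↑) '' I : Set ℤ) d := by
  classical
  have hex : ∃ J, P J := by
    obtain ⟨n, A, -, hA, -⟩ := hP.exists
    exact ⟨A, hA⟩
  have hsub := subadditive_maxCount hex hshift
  have hbdd : BddBelow (range fun n : ℕ => (maxCount P n : ℝ) / n) :=
    ⟨0, by rintro _ ⟨n, rfl⟩; positivity⟩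
  have tendsto_lim := hsub.tendsto_lim hbdd
  have lim_mul_le (n : ℕ) : hsub.lim * n ≤ maxCount P n := by
    rcases n.eq_zero_or_pos with rfl | hn
    · simp
    · exact (le_div_iff₀ (by exact_mod_cast hn)).1 (hsub.lim_le_div hbdd hn.ne')
  have lim_pos : 0 < hsub.lim := by
    refine hκ.trans_le (ge_of_tendsto_of_frequently tendsto_lim ?_)
    refine (hP.and_eventually (eventually_gt_atTop 0)).mono ?_
    rintro n ⟨⟨A, A_subset, hA, A_card⟩, hn⟩
    rw [le_div_iff₀ (by exact_mod_cast hn)]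
    refine A_card.trans ?_
    have := count_le_maxCount hA n
    simp only [Nat.count_eq_card_filter_range, Finset.mem_coe, Finset.filter_mem_eq_inter,
      Finset.inter_eq_right.2 A_subset] at this
    exact_mod_cast this
  obtain ⟨I, hI, lower⟩ := exists_forall_finite_subset_and_mul_le_count hmono
    (exists_forall_mul_le_count hex hshift lim_mul_le)
  have upper (n : ℕ) : Nat.count (· ∈ I) n ≤ maxCount P n := by
    have hP_inter := hI (I ∩ Iio n) inter_subset_left ((finite_Iio n).inter_of_right I)
    refine le_of_eq_of_le ?_ (count_le_maxCount hP_inter n)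
    simp only [Nat.count_eq_card_filter_range]
    exact congrArg _ (Finset.filter_congr fun k hk => by simp [Finset.mem_range.1 hk])
  refine ⟨I, hI, _, half_pos lim_pos, hasDensity_image_natCast ?_⟩
  refine tendsto_of_tendsto_of_tendsto_of_le_of_le' tendsto_const_nhds tendsto_lim ?_
    (Eventually.of_forall fun n => ?_)
  · filter_upwards [eventually_gt_atTop 0] with n hn
    exact (le_div_iff₀ (by exact_mod_cast hn)).2 (lower n)
  · exact div_le_div_of_nonneg_right (by exact_mod_cast upper n) n.cast_nonneg

end Density

theorem HasDensity.infinite {I : Set ℤ} {d : ℝ} (h : HasDensity I d) (hd : 0 < d) :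
    I.Infinite := by
  intro hfin
  have upper : Tendsto (fun n : ℕ => (I.ncard : ℝ) / (2 * (n : ℝ) + 1)) atTop (𝓝 0) :=
    tendsto_const_nhds.div_atTop (tendsto_atTop_add_const_right _ _
      (tendsto_natCast_atTop_atTop.const_mul_atTop two_pos))
  refine hd.ne' (tendsto_nhds_unique h (squeeze_zero (fun n => by positivity) (fun n => ?_) upper))
  gcongr
  exact Set.inter_subset_left

section L1

variable {X : Type*} [NormedAddCommGroup X] [NormedSpace ℂ X]

theorem hasSum_norm_lp_one {ι : Type*} (c : lp (fun _ : ι => ℂ) 1) :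
    HasSum (fun i => ‖c i‖) ‖c‖ := by
  simpa using lp.hasSum_norm (p := 1) (by simp) c

section Synthesis

variable [CompleteSpace X] {ι : Type*} {v : ι → X} {M κ : ℝ}

theorem hasSum_smul_of_norm_le (hM : ∀ i, ‖v i‖ ≤ M) (c : lp (fun _ : ι => ℂ) 1) :
    HasSum (fun i => c i • v i) (∑' i, c i • v i) :=
  (Summable.of_norm_bounded ((hasSum_norm_lp_one c).summable.mul_right M) fun i => by
    rw [norm_smul]
    exact mul_le_mul_of_nonneg_left (hM i) (norm_nonneg _)).hasSum

/-- The operator from `ℓ₁` which maps the standard basis to a bounded family `v`. -/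
noncomputable def l1Synthesis (hM : ∀ i, ‖v i‖ ≤ M) : lp (fun _ : ι => ℂ) 1 →L[ℂ] X :=
  LinearMap.mkContinuous
    { toFun := fun c => ∑' i, c i • v i
      map_add' := fun c c' => (hasSum_smul_of_norm_le hM (c + c')).unique <| by
        simpa [add_smul] using (hasSum_smul_of_norm_le hM c).add (hasSum_smul_of_norm_le hM c')
      map_smul' := fun a c => (hasSum_smul_of_norm_le hM (a • c)).unique <| by
        simpa [mul_smul] using (hasSum_smul_of_norm_le hM c).const_smul a }
    M fun c => tsum_of_norm_bounded ((hasSum_norm_lp_one c).mul_left M) fun i => by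
      rw [norm_smul, mul_comm]
      exact mul_le_mul_of_nonneg_right (hM i) (norm_nonneg _)

theorem hasSum_l1Synthesis (hM : ∀ i, ‖v i‖ ≤ M) (c : lp (fun _ : ι => ℂ) 1) :
    HasSum (fun i => c i • v i) (l1Synthesis hM c) :=
  hasSum_smul_of_norm_le hM c

theorem l1Synthesis_single [DecidableEq ι] (hM : ∀ i, ‖v i‖ ≤ M) (i : ι) :
    l1Synthesis hM (lp.single 1 i 1) = v i := by
  refine (hasSum_l1Synthesis hM _).unique ?_
  simpa using hasSum_single (f := fun j => (lp.single 1 i 1 : lp (fun _ : ι => ℂ) 1) j • v j) i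
    fun j hj => by simp [lp.single_apply, Pi.single_eq_of_ne hj]

theorem antilipschitzWith_l1Synthesis (hM : ∀ i, ‖v i‖ ≤ M) (hκ : 0 < κ)
    (h : ∀ (J : Finset ι) (c : ι → ℂ), κ * ∑ i ∈ J, ‖c i‖ ≤ ‖∑ i ∈ J, c i • v i‖) :
    AntilipschitzWith (Real.toNNReal κ⁻¹) (l1Synthesis hM) := by
  refine AddMonoidHomClass.antilipschitz_of_bound _ fun c => ?_
  rw [Real.coe_toNNReal _ (inv_pos.2 hκ).le, inv_mul_eq_div, le_div_iff₀ hκ, mul_comm]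
  exact le_of_tendsto_of_tendsto' ((hasSum_norm_lp_one c).const_mul κ)
    (hasSum_l1Synthesis hM c).norm fun J => h J c

theorem topologicalClosure_span_range_eq_range_l1Synthesis (hM : ∀ i, ‖v i‖ ≤ M)
    (hclosed : IsClosed (range (l1Synthesis hM))) :
    (Submodule.span ℂ (range v)).topologicalClosure = (l1Synthesis hM).range := by
  classical
  refine le_antisymm (Submodule.topologicalClosure_minimal _ ?_ hclosed) ?_
  · rw [Submodule.span_le]
    rintro _ ⟨i, rfl⟩
    exact ⟨_, l1Synthesis_single hM i⟩
  · rintro _ ⟨c, rfl⟩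
    refine mem_closure_of_tendsto (hasSum_l1Synthesis hM c) (Eventually.of_forall fun J => ?_)
    exact Submodule.sum_mem _ fun i _ => Submodule.smul_mem _ _
      (Submodule.subset_span (mem_range_self i))

theorem equivalentToL1Basis_range [DecidableEq ι] (hM : ∀ i, ‖v i‖ ≤ M) (hκ : 0 < κ)
    (h : ∀ (J : Finset ι) (c : ι → ℂ), κ * ∑ i ∈ J, ‖c i‖ ≤ ‖∑ i ∈ J, c i • v i‖) :
    EquivalentToL1Basis (ι := ι) (range v) := by
  have anti := antilipschitzWith_l1Synthesis hM hκ h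
  have hclosed : IsClosed (range (l1Synthesis hM)) :=
    anti.isClosed_range (l1Synthesis hM).uniformContinuous
  have v_injective : Function.Injective v := fun i j hij => by
    have := anti.injective <|
      (l1Synthesis_single hM i).trans (hij.trans (l1Synthesis_single hM j).symm)
    by_contra hne
    simpa [lp.single_apply, hne] using congrArg (fun c : lp (fun _ : ι => ℂ) 1 => c i) this
  unfold EquivalentToL1Basis
  rw [topologicalClosure_span_range_eq_range_l1Synthesis hM hclosed]
  exact ⟨Equiv.ofInjective v v_injective, (l1Synthesis hM).equivRange anti.injective hclosed,
    fun i => l1Synthesis_single hM i⟩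

end Synthesis

theorem EquivalentToL1Basis.exists_mul_sum_norm_le {ι : Type*} [DecidableEq ι] {Δ : Set X}
    (h : EquivalentToL1Basis (ι := ι) Δ) :
    ∃ (e : ι ≃ Δ) (κ : ℝ), 0 < κ ∧ ∀ (J : Finset ι) (c : ι → ℂ),
      κ * ∑ i ∈ J, ‖c i‖ ≤ ‖∑ i ∈ J, c i • (e i : X)‖ := by
  obtain ⟨e, γ, hγ⟩ := h
  obtain ⟨C, C_pos, hC⟩ := γ.symm.toContinuousLinearMap.bound
  refine ⟨e, C⁻¹, inv_pos.2 C_pos, fun J c => ?_⟩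
  let u : lp (fun _ : ι => ℂ) 1 := ∑ i ∈ J, lp.single 1 i (c i)
  have norm_u : ‖u‖ = ∑ i ∈ J, ‖c i‖ := by
    simpa using lp.norm_sum_single (E := fun _ : ι => ℂ) (p := 1) (by simp) c J
  have γ_u : (γ u : X) = ∑ i ∈ J, c i • (e i : X) := by
    simp only [u, map_sum, Submodule.coe_sum, ← hγ, ← Submodule.coe_smul, ← map_smul,
      ← lp.single_smul, smul_eq_mul, mul_one]
  rw [← norm_u, ← γ_u, inv_mul_le_iff₀ C_pos]
  simpa using hC (γ u)

/-- The `ℓ₁` norm of finitely supported coefficients on `I` is controlled, with constant `κ`, by the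
norm of the corresponding combination of the orbit of `x` under `α`. -/
def HasL1LowerBound (α : X ≃ₗᵢ[ℂ] X) (x : X) (κ : ℝ) (I : Set ℤ) : Prop :=
  ∀ J : Finset ℤ, (J : Set ℤ) ⊆ I → ∀ c : ℤ → ℂ,
    κ * ∑ i ∈ J, ‖c i‖ ≤ ‖∑ i ∈ J, c i • (α ^ i) x‖

section LowerBound

variable {α : X ≃ₗᵢ[ℂ] X} {x : X} {κ : ℝ} {I : Set ℤ}

theorem HasL1LowerBound.mono {I' : Set ℤ} (h : HasL1LowerBound α x κ I) (hI : I' ⊆ I) :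
    HasL1LowerBound α x κ I' :=
  fun J hJ c => h J (hJ.trans hI) c

theorem hasL1LowerBound_coe_finset {J : Finset ℤ}
    (h : ∀ c : ℤ → ℂ, κ * ∑ i ∈ J, ‖c i‖ ≤ ‖∑ i ∈ J, c i • (α ^ i) x‖) :
    HasL1LowerBound α x κ J := by
  intro J' hJ' c
  simpa [ite_smul, apply_ite, Finset.sum_ite_mem, Finset.inter_eq_right.2 (Finset.coe_subset.1 hJ')]
    using h fun i => if i ∈ J' then c i else 0

theorem zpow_add_apply (k l : ℤ) : (α ^ (k + l)) x = (α ^ k) ((α ^ l) x) := by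
  rw [zpow_add, LinearIsometryEquiv.coe_mul, Function.comp_apply]

theorem HasL1LowerBound.preimage_add (h : HasL1LowerBound α x κ I) (k : ℤ) :
    HasL1LowerBound α x κ ((k + ·) ⁻¹' I) := by
  intro J hJ c
  rw [← (α ^ k).norm_map, map_sum]
  simpa [zpow_add_apply] using
    h (J.map (addLeftEmbedding k)) (by rw [Finset.coe_map]; exact image_subset_iff.2 hJ)
      fun i => c (i - k)

theorem HasL1LowerBound.isL1IsomorphismSet [CompleteSpace X] (h : HasL1LowerBound α x κ I)
    (hκ : 0 < κ) : IsL1IsomorphismSet α x I := by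
  classical
  unfold IsL1IsomorphismSet
  rw [image_eq_range]
  refine equivalentToL1Basis_range (M := ‖x‖) (fun i => ((α ^ (i : ℤ)).norm_map x).le) hκ ?_
  intro J c
  simpa using h (J.map (Function.Embedding.subtype _)) (by simp)
    fun i => if hi : i ∈ I then c ⟨i, hi⟩ else 0

theorem injective_zpow_apply (hinf : (range fun i : ℤ => (α ^ i) x).Infinite) :
    Function.Injective fun i : ℤ => (α ^ i) x := by
  intro i j hij
  by_contra hne
  wlog hlt : j < i generalizing i j
  · exact this hij.symm (Ne.symm hne) (lt_of_le_of_ne (not_lt.1 hlt) hne)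
  have periodic : Function.Periodic (fun i : ℤ => (α ^ i) x) (i - j) := fun k => by
    change (α ^ (k + (i - j))) x = (α ^ k) x
    rw [← add_comm_sub, zpow_add_apply, show (α ^ i) x = (α ^ j) x from hij,
      ← zpow_add_apply, sub_add_cancel]
  refine hinf ?_
  rw [← periodic.image_Ioc (sub_pos.2 hlt) 0]
  exact (finite_Ioc _ _).image _

theorem IsL1IsomorphismSet.exists_hasL1LowerBound (h : IsL1IsomorphismSet α x I)
    (hI : I.Infinite) : ∃ κ, 0 < κ ∧ HasL1LowerBound α x κ I := by
  classical
  obtain ⟨e, κ, κ_pos, hκ⟩ := EquivalentToL1Basis.exists_mul_sum_norm_le h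
  have image_infinite : ((fun i : ℤ => (α ^ i) x) '' I).Infinite := by
    have := hI.to_subtype
    exact Set.infinite_coe_iff.1 (Infinite.of_injective e e.injective)
  have orbit_injective := injective_zpow_apply (image_infinite.mono (image_subset_range _ _))
  -- The basis may be matched with the orbit in a different order.
  let ψ : I ≃ I := (Equiv.Set.image _ I orbit_injective).trans e.symm
  have e_ψ (i : I) : (e (ψ i) : X) = (α ^ (i : ℤ)) x := by simp [ψ]
  refine ⟨κ, κ_pos, fun J hJ c => ?_⟩
  rw [← Finset.sum_subtype_of_mem (fun i => ‖c i‖) (p := (· ∈ I)) fun i hi => hJ hi,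
    ← Finset.sum_subtype_of_mem (fun i => c i • (α ^ i) x) (p := (· ∈ I)) fun i hi => hJ hi]
  simpa [e_ψ] using hκ ((J.subtype (· ∈ I)).map ψ.toEmbedding) fun i => c (ψ.symm i)

end LowerBound

end L1

section CoverEntropy

open Dynamics SetRel
open scoped Uniformity

variable {X : Type*} {T : X → X} {F : Set X}

theorem coverMincard_comp_inter_comp_le {U V : SetRel X X} [U.IsSymm] [V.IsSymm] (n : ℕ) :
    coverMincard T F ((U ○ U) ∩ (V ○ V)) n ≤ coverMincard T F U n * coverMincard T F V n := by
  classical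
  rcases F.eq_empty_or_nonempty with rfl | hF
  · simp
  rcases eq_or_ne (coverMincard T F U n) ⊤ with hU | hU
  · simp [hU, ENat.top_mul, coverMincard_eq_zero_iff, hF.ne_empty]
  rcases eq_or_ne (coverMincard T F V n) ⊤ with hV | hV
  · simp [hV, ENat.mul_top, coverMincard_eq_zero_iff, hF.ne_empty]
  obtain ⟨s, hs, hsU⟩ := (coverMincard_finite_iff T F U n).1 hU.lt_top
  obtain ⟨t, ht, htV⟩ := (coverMincard_finite_iff T F V n).1 hV.lt_top
  have hnear (q : X × X) : ∃ z, (∃ x, (x, q.1) ∈ dynEntourage T U n ∧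
      (x, q.2) ∈ dynEntourage T V n) →
      (z, q.1) ∈ dynEntourage T U n ∧ (z, q.2) ∈ dynEntourage T V n := by
    by_cases h : ∃ x, (x, q.1) ∈ dynEntourage T U n ∧ (x, q.2) ∈ dynEntourage T V n
    · exact h.imp fun z hz _ => hz
    · exact ⟨q.1, fun h' => absurd h' h⟩
  choose z hz using hnear
  have hcover : IsDynCoverOf T F ((U ○ U) ∩ (V ○ V)) n ((s ×ˢ t).image z) := by
    intro x hx
    obtain ⟨a, ha, hxa⟩ := hs hx
    obtain ⟨b, hb, hxb⟩ := ht hx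
    obtain ⟨hza, hzb⟩ := hz (a, b) ⟨x, hxa, hxb⟩
    refine ⟨z (a, b), Finset.mem_coe.2 (Finset.mem_image_of_mem z (Finset.mk_mem_product ha hb)),
      mem_dynEntourage.2 fun k hk => ⟨⟨T^[k] a, ?_, ?_⟩, T^[k] b, ?_, ?_⟩⟩
    exacts [mem_dynEntourage.1 hxa k hk, U.symm (mem_dynEntourage.1 hza k hk),
      mem_dynEntourage.1 hxb k hk, V.symm (mem_dynEntourage.1 hzb k hk)]
  calc coverMincard T F ((U ○ U) ∩ (V ○ V)) n ≤ ((s ×ˢ t).image z).card :=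
        hcover.coverMincard_le_card
    _ ≤ ((s ×ˢ t).card : ℕ∞) := by exact_mod_cast Finset.card_image_le
    _ = coverMincard T F U n * coverMincard T F V n := by
        rw [Finset.card_product, Nat.cast_mul, hsU, htV]

theorem coverEntropyEntourage_comp_inter_comp_le {U V : SetRel X X} [U.IsSymm] [V.IsSymm] :
    coverEntropyEntourage T F ((U ○ U) ∩ (V ○ V)) ≤
      coverEntropyEntourage T F U + coverEntropyEntourage T F V := by
  rcases F.eq_empty_or_nonempty with rfl | hF
  · simp
  have hne (W : SetRel X X) : coverEntropyEntourage T F W ≠ ⊥ :=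
    (EReal.bot_lt_zero.trans_le (coverEntropyEntourage_nonneg T hF W)).ne'
  refine (ExpGrowth.expGrowthSup_monotone fun n => ?_).trans
    (ExpGrowth.expGrowthSup_mul_le (.inl (hne U)) (.inr (hne V)))
  simpa only [Pi.mul_apply, ENat.toENNReal_mul] using
    ENat.toENNReal_mono (coverMincard_comp_inter_comp_le (T := T) (F := F) (U := U) (V := V) n)

theorem coverEntropy_inf_le (u v : UniformSpace X) :
    @coverEntropy X (u ⊓ v) T F ≤ @coverEntropy X u T F + @coverEntropy X v T F := by
  refine iSup₂_le fun W (hW : W ∈ 𝓤[u ⊓ v]) => ?_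
  obtain ⟨U, hU, V, hV, rfl⟩ := Filter.mem_inf_iff.1 (inf_uniformity ▸ hW)
  obtain ⟨U', hU', _, hUU'⟩ := @comp_symm_mem_uniformity_sets X u U hU
  obtain ⟨V', hV', _, hVV'⟩ := @comp_symm_mem_uniformity_sets X v V hV
  calc coverEntropyEntourage T F (U ∩ V)
      ≤ coverEntropyEntourage T F ((U' ○ U') ∩ (V' ○ V')) :=
        coverEntropyEntourage_antitone T F (inter_subset_inter hUU' hVV')
    _ ≤ coverEntropyEntourage T F U' + coverEntropyEntourage T F V' :=
        coverEntropyEntourage_comp_inter_comp_le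
    _ ≤ _ := add_le_add (let _ := u; coverEntropyEntourage_le_coverEntropy T F hU')
        (let _ := v; coverEntropyEntourage_le_coverEntropy T F hV')

theorem coverEntropy_top_le_zero : @coverEntropy X ⊤ T F ≤ 0 := by
  refine iSup₂_le fun W (hW : W ∈ 𝓤[⊤]) => ?_
  obtain rfl := Filter.mem_top.1 (top_uniformity ▸ hW)
  rcases F.eq_empty_or_nonempty with rfl | hF
  · simp
  · exact (coverEntropyEntourage_univ T hF).le

theorem coverEntropy_iInf_le_zero_iff {ι : Type*} {u : ι → UniformSpace X} :
    @coverEntropy X (⨅ i, u i) T F ≤ 0 ↔ ∀ i, @coverEntropy X (u i) T F ≤ 0 := by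
  refine ⟨fun h i => (coverEntropy_antitone T F (iInf_le u i)).trans h, fun h => ?_⟩
  have hfinite (s : Finset ι) : @coverEntropy X (⨅ i ∈ s, u i) T F ≤ 0 := by
    classical
    induction s using Finset.induction_on with
    | empty => exact (coverEntropy_antitone T F (by simp)).trans coverEntropy_top_le_zero
    | insert i s _ ih =>
      rw [Finset.iInf_insert]
      exact (coverEntropy_inf_le _ _).trans (add_nonpos (h i) ih)
  refine iSup₂_le fun W (hW : W ∈ 𝓤[⨅ i, u i]) => ?_
  obtain ⟨s, hs⟩ := Filter.mem_iInf_finite W |>.1 (iInf_uniformity ▸ hW)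
  let _ := ⨅ i ∈ s, u i
  refine (coverEntropyEntourage_le_coverEntropy T F ?_).trans (hfinite s)
  change W ∈ 𝓤[⨅ i ∈ s, u i]
  simpa only [iInf_uniformity] using hs

end CoverEntropy

section ObservableEntropy

open Dynamics

variable {X Y : Type*} {T : X → X}

/-- The entropy of `T` as seen through the observable `f`, that is, with respect to the uniformity
pulled back along `f`. -/
noncomputable def observableEntropy [u : UniformSpace Y] (T : X → X) (f : X → Y) : EReal :=
  @coverEntropy X (u.comap f) T univ

theorem observableEntropy_comp_of_semiconj [u : UniformSpace Y] {Z : Type*} {S : Z → Z}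
    {π : X → Z} (hπ : Function.Surjective π) (hsemi : Function.Semiconj π T S) (g : Z → Y) :
    observableEntropy T (g ∘ π) = observableEntropy S g := by
  have h := coverEntropy_image_of_comap (u.comap g) hsemi univ
  rw [image_univ, hπ.range_eq, ← UniformSpace.comap_comap] at h
  exact h.symm

theorem observableEntropy_complex_le (T : X → X) (f : X → ℂ) :
    observableEntropy T f ≤
      observableEntropy T (fun x => (f x).re) + observableEntropy T (fun x => (f x).im) := by
  have hunif : UniformSpace.comap f inferInstance =
      UniformSpace.comap (fun x => (f x).re) inferInstance ⊓
      UniformSpace.comap (fun x => (f x).im) inferInstance := by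
    rw [← Complex.isUniformEmbedding_equivRealProd.isUniformInducing.comap_uniformSpace,
      instUniformSpaceProd, UniformSpace.comap_inf, UniformSpace.comap_inf]
    simp only [← UniformSpace.comap_comap]
    rfl
  rw [observableEntropy, hunif]
  exact coverEntropy_inf_le _ _

theorem exists_isDynNetIn_of_le_netMaxcard {F : Set X} {U : SetRel X X} {n : ℕ} {b : ℝ}
    (h : ENNReal.ofReal b ≤ netMaxcard T F U n) :
    ∃ E : Finset X, IsDynNetIn T F U n E ∧ b ≤ E.card := by
  rcases eq_or_ne (netMaxcard T F U n) ⊤ with htop | htop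
  · obtain ⟨E, hE, hcard⟩ := (netMaxcard_infinite_iff T F U n).1 htop ⌈b⌉₊
    exact ⟨E, hE, (Nat.le_ceil b).trans (by exact_mod_cast hcard)⟩
  · obtain ⟨E, hE, hcard⟩ := (netMaxcard_finite_iff T F U n).1 htop.lt_top
    refine ⟨E, hE, ?_⟩
    rw [← hcard, ENat.toENNReal_coe, ← ENNReal.ofReal_natCast] at h
    exact (ENNReal.ofReal_le_ofReal_iff (Nat.cast_nonneg _)).1 h

theorem exists_isDynCoverOf_of_coverMincard_le {F : Set X} {U : SetRel X X} {n : ℕ} {b : ℝ}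
    (hb : 0 ≤ b) (h : coverMincard T F U n ≤ ENNReal.ofReal b) :
    ∃ E : Finset X, IsDynCoverOf T F U n E ∧ E.card ≤ b := by
  have hlt : coverMincard T F U n < ⊤ := by
    rw [lt_top_iff_ne_top]
    intro htop
    simp [htop] at h
  obtain ⟨E, hE, hcard⟩ := (coverMincard_finite_iff T F U n).1 hlt
  refine ⟨E, hE, ?_⟩
  rw [← hcard, ENat.toENNReal_coe, ← ENNReal.ofReal_natCast] at h
  exact (ENNReal.ofReal_le_ofReal_iff hb).1 h

theorem ereal_exp_coe_mul_natCast (c : ℝ) (n : ℕ) :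
    EReal.exp ((c : EReal) * n) = ENNReal.ofReal (Real.exp (c * n)) := by
  rw [← EReal.exp_coe]
  norm_cast

variable [PseudoMetricSpace Y] {f : X → Y}

theorem eventually_exists_cover_of_observableEntropy_le_zero (h : observableEntropy T f ≤ 0)
    {ε c : ℝ} (hε : 0 < ε) (hc : 0 < c) :
    ∀ᶠ n : ℕ in atTop, ∃ E : Finset X, (E.card : ℝ) ≤ Real.exp (c * n) ∧
      ∀ x, ∃ y ∈ E, ∀ k < n, dist (f (T^[k] x)) (f (T^[k] y)) < ε := by
  let _ : UniformSpace X := UniformSpace.comap f inferInstance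
  have hlt : coverEntropyEntourage T univ {p | dist (f p.1) (f p.2) < ε} < c :=
    ((coverEntropyEntourage_le_coverEntropy T univ
      (preimage_mem_comap (Metric.dist_mem_uniformity hε))).trans h).trans_lt
      (EReal.coe_pos.2 hc)
  filter_upwards [ExpGrowth.eventually_le_exp hlt] with n hn
  rw [ereal_exp_coe_mul_natCast] at hn
  obtain ⟨E, hE, hcard⟩ := exists_isDynCoverOf_of_coverMincard_le (Real.exp_pos _).le hn
  refine ⟨E, hcard, fun x => ?_⟩
  obtain ⟨y, hy, hxy⟩ := hE (mem_univ x)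
  exact ⟨y, hy, mem_dynEntourage.1 hxy⟩

theorem exists_frequently_separated_of_observableEntropy_pos (h : 0 < observableEntropy T f) :
    ∃ ε c : ℝ, 0 < ε ∧ 0 < c ∧ ∃ᶠ n : ℕ in atTop, ∃ E : Finset X, Real.exp (c * n) ≤ E.card ∧
      ∀ x ∈ E, ∀ y ∈ E, x ≠ y → ∃ k < n, ε ≤ dist (f (T^[k] x)) (f (T^[k] y)) := by
  let _ : UniformSpace X := UniformSpace.comap f inferInstance
  have hbasis : (uniformity X).HasBasis (0 < ·) fun ε => {p | dist (f p.1) (f p.2) < ε} :=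
    Metric.uniformity_basis_dist.comap _
  rw [observableEntropy, coverEntropy_eq_iSup_basis_netEntropyEntourage hbasis] at h
  simp only [lt_iSup_iff] at h
  obtain ⟨ε, hε, hpos⟩ := h
  obtain ⟨c, hc, hcε⟩ := EReal.exists_between_coe_real hpos
  refine ⟨ε, c, hε, EReal.coe_pos.1 hc, (ExpGrowth.frequently_exp_le hcε).mono fun n hn => ?_⟩
  rw [ereal_exp_coe_mul_natCast] at hn
  obtain ⟨E, hE, hcard⟩ := exists_isDynNetIn_of_le_netMaxcard hn
  refine ⟨E, hcard, fun x hx y hy hxy => ?_⟩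
  by_contra! hclose
  refine Set.not_disjoint_iff.2 ⟨y, ?_, ?_⟩ (hE.2 hx hy hxy)
  · exact mem_dynEntourage.2 hclose
  · exact mem_dynEntourage.2 fun k _ => by simpa using hε

theorem topEntropy_le_zero_iff {K ι : Type*} [TopologicalSpace K] [CompactSpace K] [T2Space K]
    (T : K ≃ₜ K) {g : ι → C(K, ℂ)} (hg : ∀ x y, (∀ i, g i x = g i y) → x = y) :
    topEntropy T ≤ 0 ↔ ∀ i, observableEntropy T (g i) ≤ 0 := by
  let Φ : K → ι → ℂ := fun x i => g i x
  have hΦ : IsClosedEmbedding Φ :=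
    Continuous.isClosedEmbedding (by fun_prop) fun x y hxy => hg x y (congrFun hxy)
  have hunif : (uniformSpaceOfCompactR1 : UniformSpace K) =
      ⨅ i, UniformSpace.comap (g i) inferInstance := by
    rw [unique_uniformity_of_compact (u := uniformSpaceOfCompactR1)
      (u' := UniformSpace.comap Φ inferInstance) rfl
      hΦ.eq_induced.symm, Pi.uniformSpace_eq, UniformSpace.comap_iInf]
    simp only [← UniformSpace.comap_comap]
    rfl
  rw [topEntropy, hunif]
  exact coverEntropy_iInf_le_zero_iff

end ObservableEntropy

section Signs

variable {ι : Type*} [DecidableEq ι]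

/-- The sum of `v` over `S` with sign `+` on `t` and `-` on `S \ t`: a realization of the Rademacher
sum with coefficients `v`. -/
def signedSum {E : Type*} [AddCommGroup E] (S : Finset ι) (v : ι → E) (t : Finset ι) : E :=
  ∑ i ∈ S, if i ∈ t then v i else -v i

theorem map_signedSum {E F : Type*} [AddCommGroup E] [AddCommGroup F] (φ : E →+ F) (S : Finset ι)
    (v : ι → E) (t : Finset ι) : φ (signedSum S v t) = signedSum S (φ ∘ v) t := by
  simp only [signedSum, map_sum, apply_ite φ, map_neg, Function.comp_apply]

theorem sum_powerset_exp_signedSum_le (S : Finset ι) (v : ι → ℝ) :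
    ∑ t ∈ S.powerset, Real.exp (signedSum S v t) ≤
      2 ^ S.card * Real.exp (∑ i ∈ S, v i ^ 2 / 2) := by
  have exp_signedSum : ∀ t ∈ S.powerset, Real.exp (signedSum S v t) =
      (∏ i ∈ t, Real.exp (v i)) * ∏ i ∈ S \ t, Real.exp (-v i) := fun t ht => by
    have hts := Finset.mem_powerset.1 ht
    rw [signedSum, Finset.sum_ite, Finset.filter_mem_eq_inter, Finset.filter_notMem_eq_sdiff,
      Finset.inter_eq_right.2 hts, Real.exp_add, Real.exp_sum, Real.exp_sum]
  calc ∑ t ∈ S.powerset, Real.exp (signedSum S v t)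
      = ∏ i ∈ S, (Real.exp (v i) + Real.exp (-v i)) := by
        rw [Finset.sum_congr rfl exp_signedSum, Finset.prod_add]
    _ = ∏ i ∈ S, 2 * Real.cosh (v i) :=
        Finset.prod_congr rfl fun i _ => by rw [Real.cosh_eq]; ring
    _ ≤ ∏ i ∈ S, 2 * Real.exp (v i ^ 2 / 2) := by
        gcongr with i
        exact Real.cosh_le_exp_half_sq _
    _ = 2 ^ S.card * Real.exp (∑ i ∈ S, v i ^ 2 / 2) := by
        rw [Finset.prod_mul_distrib, Finset.prod_const, Real.exp_sum]

theorem card_filter_signedSum_ge_mul_exp_le {S : Finset ι} {v : ι → ℝ} {M a : ℝ} (ha : 0 ≤ a)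
    (hM : 0 < M) (hv : ∀ i ∈ S, |v i| ≤ M) :
    ((S.powerset.filter fun t => a * S.card ≤ signedSum S v t).card : ℝ) *
      Real.exp (a ^ 2 / (2 * M ^ 2) * S.card) ≤ 2 ^ S.card := by
  let l := a / M ^ 2
  have sum_sq_le : ∑ i ∈ S, (l * v i) ^ 2 / 2 ≤ a ^ 2 / (2 * M ^ 2) * S.card := by
    rw [mul_comm, ← nsmul_eq_mul]
    refine Finset.sum_le_card_nsmul _ _ _ fun i hi => ?_
    calc (l * v i) ^ 2 / 2 = l ^ 2 * |v i| ^ 2 / 2 := by rw [mul_pow, sq_abs]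
      _ ≤ l ^ 2 * M ^ 2 / 2 := by gcongr; exact hv i hi
      _ = a ^ 2 / (2 * M ^ 2) := by simp only [l]; field_simp
  have markov : ((S.powerset.filter fun t => a * S.card ≤ signedSum S v t).card : ℝ) *
      Real.exp (l * (a * S.card)) ≤
        ∑ t ∈ S.powerset, Real.exp (signedSum S (fun i => l * v i) t) := by
    rw [← nsmul_eq_mul]
    refine (Finset.card_nsmul_le_sum _ _ _ fun t ht => ?_).trans
      (Finset.sum_le_sum_of_subset_of_nonneg (Finset.filter_subset _ _) fun _ _ _ =>
        (Real.exp_pos _).le)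
    rw [show signedSum S (fun i => l * v i) t = l * signedSum S v t from
      (map_signedSum (AddMonoidHom.mulLeft l) S v t).symm]
    have := (Finset.mem_filter.1 ht).2
    gcongr
  have exponent : l * (a * S.card) =
      a ^ 2 / (2 * M ^ 2) * S.card + a ^ 2 / (2 * M ^ 2) * S.card := by
    simp only [l]; field_simp; ring
  rw [exponent, Real.exp_add, ← mul_assoc] at markov
  refine le_of_mul_le_mul_right (markov.trans ?_) (Real.exp_pos _)
  exact (sum_powerset_exp_signedSum_le S _).trans (by gcongr)

theorem exp_le_card_of_forall_exists_le_signedSum {S : Finset ι} {X : Type*} {E : Finset X}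
    {v : X → ι → ℝ} {M a : ℝ} (ha : 0 ≤ a) (hM : 0 < M) (hv : ∀ x ∈ E, ∀ i ∈ S, |v x i| ≤ M)
    (h : ∀ t ⊆ S, ∃ x ∈ E, a * S.card ≤ signedSum S (v x) t) :
    Real.exp (a ^ 2 / (2 * M ^ 2) * S.card) ≤ E.card := by
  have powerset_subset : S.powerset ⊆
      E.biUnion fun x => S.powerset.filter fun t => a * S.card ≤ signedSum S (v x) t := by
    intro t ht
    obtain ⟨x, hx, hxt⟩ := h t (Finset.mem_powerset.1 ht)
    exact Finset.mem_biUnion.2 ⟨x, hx, Finset.mem_filter.2 ⟨ht, hxt⟩⟩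
  have card_le : (2 : ℝ) ^ S.card ≤
      ∑ x ∈ E, ((S.powerset.filter fun t => a * S.card ≤ signedSum S (v x) t).card : ℝ) := by
    have := (Finset.card_le_card powerset_subset).trans Finset.card_biUnion_le
    rw [Finset.card_powerset] at this
    exact_mod_cast this
  refine le_of_mul_le_mul_left ?_ (show (0 : ℝ) < 2 ^ S.card by positivity)
  calc (2 : ℝ) ^ S.card * Real.exp (a ^ 2 / (2 * M ^ 2) * S.card)
      ≤ ∑ x ∈ E, ((S.powerset.filter fun t => a * S.card ≤ signedSum S (v x) t).card : ℝ) *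
          Real.exp (a ^ 2 / (2 * M ^ 2) * S.card) := by
        rw [← Finset.sum_mul]
        gcongr
    _ ≤ ∑ _x ∈ E, (2 : ℝ) ^ S.card :=
        Finset.sum_le_sum fun x hx => card_filter_signedSum_ge_mul_exp_le ha hM (hv x hx)
    _ = 2 ^ S.card * E.card := by rw [Finset.sum_const, nsmul_eq_mul, mul_comm]

theorem exists_norm_le_two_mul_re_I_pow_mul (z : ℂ) :
    ∃ k : Fin 4, ‖z‖ ≤ 2 * (Complex.I ^ (k : ℕ) * z).re := by
  have hz := Complex.norm_le_abs_re_add_abs_im z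
  by_contra! hlt
  have h0 := hlt 0
  have h1 := hlt 1
  have h2 := hlt 2
  have h3 := hlt 3
  simp only [Fin.isValue, Fin.coe_ofNat_eq_mod, Nat.zero_mod, pow_zero, one_mul, Nat.one_mod,
    pow_one, Complex.mul_re, Complex.I_re, zero_mul, Complex.I_im, zero_sub, mul_neg, Nat.reduceMod,
    Complex.I_sq, neg_mul, Complex.neg_re, Nat.mod_succ, Complex.I_pow_three, neg_neg]
    at h0 h1 h2 h3
  grind

theorem exp_le_four_mul_card_of_forall_exists_le_norm_signedSum {S : Finset ι} {X : Type*}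
    {E : Finset X} {v : X → ι → ℂ} {M a : ℝ} (ha : 0 ≤ a) (hM : 0 < M)
    (hv : ∀ x ∈ E, ∀ i ∈ S, ‖v x i‖ ≤ M)
    (h : ∀ t ⊆ S, ∃ x ∈ E, 2 * a * S.card ≤ ‖signedSum S (v x) t‖) :
    Real.exp (a ^ 2 / (2 * M ^ 2) * S.card) ≤ 4 * E.card := by
  let φ (k : Fin 4) : ℂ →+ ℝ :=
    Complex.reAddGroupHom.comp (AddMonoidHom.mulLeft (Complex.I ^ (k : ℕ)))
  have abs_φ_le (k : Fin 4) (z : ℂ) : |φ k z| ≤ ‖z‖ :=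
    (Complex.abs_re_le_norm _).trans (by simp)
  refine (exp_le_card_of_forall_exists_le_signedSum (E := E ×ˢ Finset.univ)
    (v := fun p => φ p.2 ∘ v p.1) ha hM ?_ ?_).trans (by simp [mul_comm])
  · intro p hp i hi
    exact (abs_φ_le _ _).trans (hv p.1 (Finset.mem_product.1 hp).1 i hi)
  · intro t ht
    obtain ⟨x, hx, hxt⟩ := h t ht
    obtain ⟨k, hk⟩ := exists_norm_le_two_mul_re_I_pow_mul (signedSum S (v x) t)
    refine ⟨(x, k), Finset.mk_mem_product hx (Finset.mem_univ k), ?_⟩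
    rw [← map_signedSum]
    change _ ≤ (Complex.I ^ (k : ℕ) * signedSum S (v x) t).re
    linarith

end Signs

section PositiveEntropy

variable {X : Type*} {T : X → X}

theorem exp_le_four_mul_card_of_forall_exists_dist_lt {ι : Type*} [DecidableEq ι] {S : Finset ι}
    {v : X → ι → ℂ} {E : Finset X} {κ M : ℝ} (hκ : 0 ≤ κ) (hM : 0 < M) (hv : ∀ x i, ‖v x i‖ ≤ M)
    (hlarge : ∀ t ⊆ S, ∃ x, κ * S.card ≤ ‖signedSum S (v x) t‖)
    (hE : ∀ x, ∃ y ∈ E, ∀ i ∈ S, dist (v x i) (v y i) < κ / 2) :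
    Real.exp ((κ / 4) ^ 2 / (2 * M ^ 2) * S.card) ≤ 4 * E.card := by
  refine exp_le_four_mul_card_of_forall_exists_le_norm_signedSum (v := v) (by positivity) hM
    (fun x _ i _ => hv x i) fun t ht => ?_
  obtain ⟨x, hx⟩ := hlarge t ht
  obtain ⟨y, hy, hxy⟩ := hE x
  refine ⟨y, hy, ?_⟩
  have close : ‖signedSum S (v x) t - signedSum S (v y) t‖ ≤ S.card * (κ / 2) := by
    rw [signedSum, signedSum, ← Finset.sum_sub_distrib, ← nsmul_eq_mul, ← Finset.sum_const]
    refine norm_sum_le_of_le _ fun i hi => ?_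
    split_ifs
    · exact (dist_eq_norm (v x i) (v y i)).symm.trans_le (hxy i hi).le
    · rw [← dist_eq_norm, dist_neg_neg]
      exact (hxy i hi).le
  have := norm_sub_norm_le (signedSum S (v x) t) (signedSum S (v y) t)
  linarith

theorem observableEntropy_pos_of_frequently_le_norm_signedSum {f : X → ℂ} {κ M d : ℝ} (hκ : 0 < κ)
    (hM : 0 < M) (hd : 0 < d) (hf : ∀ x, ‖f x‖ ≤ M)
    (h : ∃ᶠ n : ℕ in atTop, ∃ S ⊆ Finset.range n, d * n ≤ S.card ∧
      ∀ t ⊆ S, ∃ x, κ * S.card ≤ ‖signedSum S (fun i => f (T^[i] x)) t‖) :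
    0 < observableEntropy T f := by
  by_contra! hzero
  let c := (κ / 4) ^ 2 / (2 * M ^ 2) * d / 2
  have hc : 0 < c := by positivity
  have four_lt : ∀ᶠ n : ℕ in atTop, Real.log 4 < c * n :=
    (tendsto_natCast_atTop_atTop.const_mul_atTop hc).eventually_gt_atTop _
  obtain ⟨n, ⟨S, hSn, hSd, hlarge⟩, ⟨E, hE, hcover⟩, hn⟩ := (h.and_eventually
    ((eventually_exists_cover_of_observableEntropy_le_zero hzero (half_pos hκ) hc).and
      four_lt)).exists
  refine lt_irrefl (Real.exp (2 * (c * n))) ?_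
  calc Real.exp (2 * (c * n)) = Real.exp ((κ / 4) ^ 2 / (2 * M ^ 2) * (d * n)) := by
        congr 1; simp only [c]; ring
    _ ≤ Real.exp ((κ / 4) ^ 2 / (2 * M ^ 2) * S.card) := by gcongr
    _ ≤ 4 * E.card :=
        exp_le_four_mul_card_of_forall_exists_dist_lt hκ.le hM (fun x i => hf _) hlarge fun x => by
          obtain ⟨y, hy, hxy⟩ := hcover x
          exact ⟨y, hy, fun k hk => hxy k (Finset.mem_range.1 (hSn hk))⟩
    _ ≤ 4 * Real.exp (c * n) := by gcongr
    _ < Real.exp (c * n) * Real.exp (c * n) := by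
        gcongr
        exact (Real.log_lt_iff_lt_exp (by norm_num)).1 hn
    _ = Real.exp (2 * (c * n)) := by rw [← Real.exp_add, two_mul]

theorem HasDensity.eventually_exists_finset {I : Set ℤ} {d d' : ℝ} (h : HasDensity I d)
    (hd : d' < d) :
    ∀ᶠ n : ℕ in atTop, ∃ S ⊆ Finset.range (2 * n + 1), (∀ k ∈ S, -(n : ℤ) + k ∈ I) ∧
      d' * (2 * n + 1 : ℕ) ≤ S.card := by
  classical
  filter_upwards [h.eventually_const_lt hd] with n hn
  let S := (Finset.range (2 * n + 1)).filter fun k : ℕ => -(n : ℤ) + k ∈ I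
  have image_S : I ∩ Icc (-(n : ℤ)) n = (fun k : ℕ => -(n : ℤ) + k) '' S := by
    ext i
    simp only [mem_inter_iff, mem_Icc, mem_image, S, Finset.mem_coe, Finset.mem_filter,
      Finset.mem_range]
    constructor
    · rintro ⟨hi, hni, hin⟩
      have hcast : -(n : ℤ) + (i + n).toNat = i := by omega
      exact ⟨(i + n).toNat, ⟨by omega, hcast.symm ▸ hi⟩, hcast⟩
    · rintro ⟨k, ⟨hk, hkI⟩, rfl⟩
      exact ⟨hkI, by omega, by omega⟩
  refine ⟨S, Finset.filter_subset _ _, fun k hk => (Finset.mem_filter.1 hk).2, ?_⟩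
  rw [image_S, ncard_image_of_injective _ fun k l hkl => by simpa using hkl, ncard_coe_finset,
    lt_div_iff₀ (by positivity)] at hn
  exact_mod_cast hn.le

section Homeomorph

variable {K : Type*} [TopologicalSpace K] [CompactSpace K] {T : K ≃ₜ K} {f : C(K, ℂ)} {κ : ℝ}

theorem inducedAut_pow_apply (T : K ≃ₜ K) (n : ℕ) (f : C(K, ℂ)) (x : K) :
    (inducedAut T ^ n) f x = f (T^[n] x) := by
  induction n generalizing x with
  | zero => rfl
  | succ n ih => rw [pow_succ', Function.iterate_succ_apply, ← ih]; rfl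

theorem HasL1LowerBound.exists_le_norm_signedSum {S : Finset ℕ} (hκ : 0 < κ)
    (h : HasL1LowerBound (inducedAut T) f κ ((↑) '' (S : Set ℕ))) (hS : S.Nonempty)
    (t : Finset ℕ) : ∃ x, κ * S.card ≤ ‖signedSum S (fun i => f (T^[i] x)) t‖ := by
  let c (i : ℤ) : ℂ := if i.toNat ∈ t then 1 else -1
  have norm_c (i : ℤ) : ‖c i‖ = 1 := by simp only [c]; split_ifs <;> simp
  have lower := h (S.map Nat.castEmbedding) (by simp) c
  simp only [norm_c, Finset.sum_const, Finset.card_map, nsmul_eq_mul, mul_one,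
    Finset.sum_map, Nat.castEmbedding_apply] at lower
  have hpos : 0 < κ * S.card := mul_pos hκ (Nat.cast_pos.2 hS.card_pos)
  by_contra! hlt
  refine lower.not_gt ((ContinuousMap.norm_lt_iff _ hpos).2 fun x => ?_)
  refine (congrArg norm ?_).trans_lt (hlt x)
  rw [ContinuousMap.sum_apply]
  refine Finset.sum_congr rfl fun i _ => ?_
  by_cases hi : i ∈ t <;> simp [c, hi, inducedAut_pow_apply]

theorem HasPosDensityL1Set.observableEntropy_pos (h : HasPosDensityL1Set T f) :
    0 < observableEntropy T f := by
  obtain ⟨I, ⟨d, hd, hdens⟩, hI⟩ := h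
  obtain ⟨κ, hκ, lower⟩ := hI.exists_hasL1LowerBound (hdens.infinite hd)
  refine observableEntropy_pos_of_frequently_le_norm_signedSum (M := ‖f‖ + 1) hκ (by positivity)
    (half_pos hd) (fun x => (f.norm_coe_le_norm x).trans (by simp)) ?_
  have hodd : Tendsto (fun n : ℕ => 2 * n + 1) atTop atTop :=
    tendsto_atTop_mono (fun n => show n ≤ 2 * n + 1 by omega) tendsto_id
  refine hodd.frequently (Eventually.frequently ?_)
  filter_upwards [hdens.eventually_exists_finset (half_lt_self hd)]
    with n ⟨S, hSn, hSI, hcard⟩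
  have hS : S.Nonempty := Finset.card_pos.1 (Nat.cast_pos.1 (lt_of_lt_of_le (by positivity) hcard))
  have lower_S : HasL1LowerBound (inducedAut T) f κ ((↑) '' (S : Set ℕ)) :=
    (lower.preimage_add (-n)).mono (image_subset_iff.2 hSI)
  exact ⟨S, hSn, hcard, fun t _ => lower_S.exists_le_norm_signedSum hκ hS t⟩

end Homeomorph

end PositiveEntropy

section IndependenceOfOrbits

variable {X Y : Type*} {T : X → X}

theorem abs_sub_sub_floor_sub_floor_lt_one (a b : ℝ) : |(a - b) - (⌊a⌋ - ⌊b⌋)| < 1 := by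
  rw [sub_sub_sub_comm, Int.self_sub_floor, Int.self_sub_floor, abs_sub_lt_iff]
  constructor <;> linarith [Int.fract_nonneg a, Int.fract_lt_one a, Int.fract_nonneg b,
    Int.fract_lt_one b]

theorem natCast_le_abs_floor_sub_floor {a b : ℝ} {m : ℕ} (h : m ≤ |a - b|) :
    (m : ℤ) ≤ |⌊a⌋ - ⌊b⌋| := by
  have := abs_sub_abs_le_abs_sub (a - b) (⌊a⌋ - ⌊b⌋)
  have := abs_sub_sub_floor_sub_floor_lt_one a b
  rw [← Int.lt_add_one_iff]
  have hlt : (m : ℝ) < |(⌊a⌋ : ℝ) - ⌊b⌋| + 1 := by linarith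
  exact_mod_cast hlt

theorem one_lt_abs_sub_of_two_le_abs_floor_sub_floor {a b : ℝ} (h : 2 ≤ |⌊a⌋ - ⌊b⌋|) :
    1 < |a - b| := by
  have := abs_sub_abs_le_abs_sub ((⌊a⌋ : ℝ) - ⌊b⌋) (a - b)
  have := abs_sub_comm (a - b) (⌊a⌋ - ⌊b⌋) ▸ abs_sub_sub_floor_sub_floor_lt_one a b
  have : (2 : ℝ) ≤ |(⌊a⌋ : ℝ) - ⌊b⌋| := by exact_mod_cast h
  linarith

/-- Along arbitrarily long orbit segments of length `n`, there are at least `κ * n` times with an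
independent family of pairs of sets, such that at each of these times the values of `f` on the two
sets of the pair are at distance at least `η`. -/
def HasFrequentIndependence [PseudoMetricSpace Y] (T : X → X) (f : X → Y) (η κ : ℝ) : Prop :=
  ∃ᶠ n : ℕ in atTop, ∃ (S : Finset (Fin n)) (P Q : Fin n → Set X),
    κ * n ≤ S.card ∧ IsIndependent P Q S ∧
      ∀ i, ∀ x ∈ P i, ∀ y ∈ Q i, η ≤ dist (f (T^[i] x)) (f (T^[i] y))

theorem HasFrequentIndependence.of_comp {Z : Type*} [PseudoMetricSpace Y] [PseudoMetricSpace Z]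
    {φ : Y → Z} (hφ : LipschitzWith 1 φ) {f : X → Y} {η κ : ℝ}
    (h : HasFrequentIndependence T (φ ∘ f) η κ) : HasFrequentIndependence T f η κ :=
  h.mono fun _ ⟨S, P, Q, hS, hPQ, hgap⟩ => ⟨S, P, Q, hS, hPQ, fun i x hx y hy =>
    (hgap i x hx y hy).trans (by simpa using hφ.dist_le_mul (f (T^[i] x)) (f (T^[i] y)))⟩

theorem exists_hasFrequentIndependence_of_observableEntropy_pos_real {g : X → ℝ}
    (hg : Bornology.IsBounded (range g)) (h : 0 < observableEntropy T g) :
    ∃ η κ, 0 < η ∧ 0 < κ ∧ HasFrequentIndependence T g η κ := by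
  obtain ⟨ε, c, hε, hc, hsep⟩ := exists_frequently_separated_of_observableEntropy_pos h
  have exp_lt : Real.exp (-(c / 2)) < 1 := Real.exp_lt_one_iff.2 (neg_lt_zero.2 (half_pos hc))
  obtain ⟨k, hk⟩ := exists_nat_one_div_lt (sub_pos.2 exp_lt)
  have hm : Real.exp (-(c / 2)) ≤ 1 - 1 / ((k + 1 : ℕ) : ℝ) := by push_cast; linarith
  set m := k + 1
  let δ := ε / m
  have hδ : 0 < δ := by positivity
  obtain ⟨a, b, hab⟩ : ∃ a b, range g ⊆ Icc a b := by
    obtain ⟨R, hR⟩ := hg.subset_closedBall 0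
    exact ⟨_, _, hR.trans (Real.closedBall_eq_Icc).subset⟩
  have abs_div_sub_div (x y : X) : |g x / δ - g y / δ| = dist (g x) (g y) / δ := by
    rw [← sub_div, abs_div, abs_of_pos hδ, Real.dist_eq]
  let D : Set ℤ := Icc ⌊a / δ⌋ ⌊b / δ⌋
  have hD (x : X) : ⌊g x / δ⌋ ∈ D := by
    have := hab (mem_range_self x)
    exact ⟨by gcongr; exact this.1, by gcongr; exact this.2⟩
  obtain ⟨κ, hκ, indep⟩ :=
    exists_isIndependent_of_forall_exists_le_abs_sub (half_pos hc) hm D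
  refine ⟨δ, κ, hδ, hκ, hsep.mono fun n ⟨E, hcard, hE⟩ => ?_⟩
  obtain ⟨S, P, Q, hS, hPQ, hgap⟩ := indep (fun (i : Fin n) x => ⟨⌊g (T^[i] x) / δ⌋, hD _⟩) E
    (fun x hx y hy hxy => by
      obtain ⟨i, hi, hdist⟩ := hE x hx y hy hxy
      refine ⟨⟨i, hi⟩, natCast_le_abs_floor_sub_floor ?_⟩
      rwa [abs_div_sub_div, le_div_iff₀ hδ, mul_div_cancel₀ _ (by positivity)])
    (by rw [Fintype.card_fin, mul_div_cancel₀ _ two_ne_zero]; exact hcard)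
  rw [Fintype.card_fin] at hS
  refine ⟨S, P, Q, hS, hPQ, fun i x hx y hy => ?_⟩
  have := one_lt_abs_sub_of_two_le_abs_floor_sub_floor (hgap i x hx y hy)
  rw [abs_div_sub_div, one_lt_div hδ] at this
  exact this.le

theorem exists_hasFrequentIndependence_of_observableEntropy_pos {f : X → ℂ}
    (hf : Bornology.IsBounded (range f)) (h : 0 < observableEntropy T f) :
    ∃ η κ, 0 < η ∧ 0 < κ ∧ HasFrequentIndependence T f η κ := by
  have of_comp (φ : ℂ → ℝ) (hφ : LipschitzWith 1 φ) (hpos : 0 < observableEntropy T (φ ∘ f)) :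
      ∃ η κ, 0 < η ∧ 0 < κ ∧ HasFrequentIndependence T f η κ := by
    obtain ⟨η, κ, hη, hκ, hfreq⟩ := exists_hasFrequentIndependence_of_observableEntropy_pos_real
      (range_comp φ f ▸ hφ.isBounded_image hf) hpos
    exact ⟨η, κ, hη, hκ, hfreq.of_comp hφ⟩
  by_cases hre : 0 < observableEntropy T (Complex.re ∘ f)
  · refine of_comp Complex.re (LipschitzWith.mk_one fun z w => ?_) hre
    rw [Real.dist_eq, dist_eq_norm, ← Complex.sub_re]
    exact Complex.abs_re_le_norm _
  · refine of_comp Complex.im (LipschitzWith.mk_one fun z w => ?_) ?_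
    · rw [Real.dist_eq, dist_eq_norm, ← Complex.sub_im]
      exact Complex.abs_im_le_norm _
    by_contra him
    exact h.not_ge ((observableEntropy_complex_le T f).trans
      (add_nonpos (not_lt.1 hre) (not_lt.1 him)))

theorem exists_isIndependent_inter_preimage_ball [PseudoMetricSpace Y] [Nonempty Y] {B : Set Y}
    (hB : TotallyBounded B) {δ : ℝ} (hδ : 0 < δ) :
    ∃ κ : ℝ, 0 < κ ∧ ∀ {ι : Type*} {X : Type*} [Finite ι] {P Q : ι → Set X} {S : Finset ι},
      IsIndependent P Q S → ∀ f : ι → X → Y, (∀ i x, f i x ∈ B) →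
        ∃ S' ⊆ S, κ * S.card ≤ S'.card ∧ ∃ a b : ι → Y,
          IsIndependent (fun i => P i ∩ f i ⁻¹' Metric.ball (a i) δ)
            (fun i => Q i ∩ f i ⁻¹' Metric.ball (b i) δ) S' := by
  obtain ⟨t, ht, hBt⟩ := Metric.totallyBounded_iff.1 hB δ hδ
  let A := insert (Classical.arbitrary Y) t
  have : Finite A := ht.insert _
  obtain ⟨κ, hκ, refine_coloring⟩ := IsIndependent.exists_inter A
  refine ⟨κ, hκ, fun hS f hf => ?_⟩
  have exists_center (i) (x) : ∃ y : A, f i x ∈ Metric.ball (y : Y) δ := by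
    obtain ⟨y, hy, hxy⟩ := mem_iUnion₂.1 (hBt (hf i x))
    exact ⟨⟨y, mem_insert_of_mem _ hy⟩, hxy⟩
  choose center hcenter using exists_center
  obtain ⟨S', hS', hcard, a, b, hind⟩ := refine_coloring hS center
  refine ⟨S', hS', hcard, fun i => a i, fun i => b i, hind.mono (fun i => ?_) fun i => ?_⟩
  · rintro x ⟨hx, hxi : center i x = a i⟩
    exact ⟨hx, by simpa only [mem_preimage, hxi] using hcenter i x⟩
  · rintro x ⟨hx, hxi : center i x = b i⟩
    exact ⟨hx, by simpa only [mem_preimage, hxi] using hcenter i x⟩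

end IndependenceOfOrbits

section Realization

variable {K : Type*} [TopologicalSpace K] [CompactSpace K] {T : K ≃ₜ K} {f : C(K, ℂ)}

theorem IsIndependent.hasL1LowerBound_inducedAut {n : ℕ} {P Q : Fin n → Set K}
    {S : Finset (Fin n)} (hS : IsIndependent P Q S) {d : Fin n → ℂ} {η δ : ℝ}
    (hd : ∀ i ∈ S, η ≤ ‖d i‖)
    (hf : ∀ i ∈ S, ∀ x ∈ P i, ∀ y ∈ Q i, ‖f (T^[i] x) - f (T^[i] y) - d i‖ ≤ δ) :
    HasL1LowerBound (inducedAut T) f (η / 4 - δ / 2)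
      ((↑) '' (S.map Fin.valEmbedding : Set ℕ)) := by
  let e : Fin n ↪ ℤ := Fin.valEmbedding.trans Nat.castEmbedding
  have image_eq : ((↑) '' (S.map Fin.valEmbedding : Set ℕ) : Set ℤ) = S.map e := by
    simp only [Finset.coe_map, image_image]
    rfl
  rw [image_eq]
  refine hasL1LowerBound_coe_finset fun c => ?_
  simp only [Finset.sum_map]
  refine hS.mul_sum_norm_le hd hf _ fun x => ?_
  refine (congrArg norm ?_).trans_le (ContinuousMap.norm_coe_le_norm _ x)
  simp [e, inducedAut_pow_apply]

theorem exists_frequently_hasL1LowerBound (h : 0 < observableEntropy T f) :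
    ∃ κ κ' : ℝ, 0 < κ ∧ 0 < κ' ∧ ∃ᶠ n : ℕ in atTop, ∃ A ⊆ Finset.range n,
      HasL1LowerBound (inducedAut T) f κ ((↑) '' (A : Set ℕ)) ∧ κ' * n ≤ A.card := by
  have range_compact := isCompact_range f.continuous
  obtain ⟨η, κ₁, hη, hκ₁, hfreq⟩ :=
    exists_hasFrequentIndependence_of_observableEntropy_pos range_compact.isBounded h
  obtain ⟨κ₂, hκ₂, refine_ball⟩ := exists_isIndependent_inter_preimage_ball
    range_compact.totallyBounded (show 0 < η / 12 by positivity)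
  refine ⟨η / 8, κ₂ * κ₁, by positivity, by positivity, hfreq.mono ?_⟩
  rintro n ⟨S, P, Q, hS, hPQ, hgap⟩
  obtain ⟨S', -, hS', a, b, hind⟩ :=
    refine_ball hPQ (fun i x => f (T^[i] x)) fun i x => mem_range_self _
  refine ⟨S'.map Fin.valEmbedding, fun k hk => ?_, ?_, ?_⟩
  · obtain ⟨i, -, rfl⟩ := Finset.mem_map.1 hk
    exact Finset.mem_range.2 i.2
  · have near_diff (i : Fin n) {x y : K} (hx : dist (f (T^[i] x)) (a i) < η / 12)
        (hy : dist (f (T^[i] y)) (b i) < η / 12) :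
        ‖f (T^[i] x) - f (T^[i] y) - (a i - b i)‖ ≤ η / 6 := by
      rw [sub_sub_sub_comm]
      rw [dist_eq_norm] at hx hy
      linarith [norm_sub_le (f (T^[i] x) - a i) (f (T^[i] y) - b i)]
    have hd : ∀ i ∈ S', η - η / 6 ≤ ‖a i - b i‖ := fun i hi => by
      obtain ⟨⟨x, hxP, hx⟩, ⟨y, hyQ, hy⟩⟩ := hind.nonempty hi
      have hxy := hgap i x hxP y hyQ
      rw [dist_eq_norm] at hxy
      linarith [norm_sub_norm_le (f (T^[i] x) - f (T^[i] y)) (a i - b i), near_diff i hx hy]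
    convert hind.hasL1LowerBound_inducedAut hd fun i _ x hx y hy => near_diff i hx.2 hy.2 using 1
    ring
  · rw [Finset.card_map, mul_assoc]
    exact (mul_le_mul_of_nonneg_left hS hκ₂.le).trans hS'

theorem hasPosDensityL1Set_iff : HasPosDensityL1Set T f ↔ 0 < observableEntropy T f := by
  refine ⟨HasPosDensityL1Set.observableEntropy_pos, fun h => ?_⟩
  obtain ⟨κ, κ', hκ, hκ', hfreq⟩ := exists_frequently_hasL1LowerBound h
  obtain ⟨I, hI, hdens⟩ := exists_hasDensity
    (P := fun J => HasL1LowerBound (inducedAut T) f κ ((↑) '' J))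
    (fun J J' hJ h' => h'.mono (image_mono hJ))
    (fun J k hJ => (hJ.preimage_add k).mono <| by
      rintro _ ⟨i, hi, rfl⟩
      exact ⟨k + i, hi, by simp⟩) hκ' hfreq
  have lower : HasL1LowerBound (inducedAut T) f κ ((↑) '' I) := fun J hJ => by
    obtain ⟨A, hA, rfl⟩ := Finset.subset_set_image_iff.1 hJ
    exact hI A hA A.finite_toSet _ (by simp)
  exact ⟨_, hdens, lower.isL1IsomorphismSet hκ⟩

end Realization

section Factors

theorem eq_of_forall_continuousMap_apply_eq {L : Type*} [TopologicalSpace L] [CompactSpace L]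
    [T2Space L] {x y : L} (h : ∀ g : C(L, ℂ), g x = g y) : x = y := by
  by_contra hxy
  obtain ⟨g, hgx, hgy, -⟩ := exists_continuous_zero_one_of_isClosed
    (isClosed_singleton (x := x)) (isClosed_singleton (x := y)) (disjoint_singleton.2 hxy)
  have := h ((⟨Complex.ofReal, Complex.continuous_ofReal⟩ : C(ℝ, ℂ)).comp g)
  simp [hgx rfl, hgy rfl] at this

variable {K : Type u} [TopologicalSpace K] {T : K ≃ₜ K}

namespace Factor

theorem comp_proj_mem_algebra (F : Factor T) (g : C(F.space, ℂ)) : g.comp F.proj ∈ F.algebra :=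
  ⟨g, rfl⟩

theorem hasZeroEntropy_iff (F : Factor T) :
    F.HasZeroEntropy ↔ ∀ f ∈ F.algebra, observableEntropy T f ≤ 0 := by
  have entropy_comp (g : C(F.space, ℂ)) :
      observableEntropy T (g.comp F.proj) = observableEntropy F.homeo g :=
    observableEntropy_comp_of_semiconj F.surjective F.equivariant g
  rw [HasZeroEntropy, entropy, topEntropy_le_zero_iff (g := fun g : C(F.space, ℂ) => g) F.homeo
    fun _ _ => eq_of_forall_continuousMap_apply_eq]
  simp only [← entropy_comp]
  constructor
  · rintro h _ ⟨g, rfl⟩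
    exact h g
  · exact fun h g => h _ (F.comp_proj_mem_algebra g)

theorem IsBelow.algebra_le {F G : Factor T} (h : F.IsBelow G) : F.algebra ≤ G.algebra := by
  obtain ⟨ρ, -, hρ⟩ := h
  rintro _ ⟨g, rfl⟩
  exact ⟨g.comp ρ, ContinuousMap.ext fun x => congrArg g (hρ x)⟩

theorem isBelow_of_algebra_le [CompactSpace K] {F G : Factor T} (h : F.algebra ≤ G.algebra) :
    F.IsBelow G := by
  have proj_eq_of_proj_eq (x y : K) (hxy : G.proj x = G.proj y) : F.proj x = F.proj y := by
    refine eq_of_forall_continuousMap_apply_eq fun g => ?_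
    obtain ⟨g', hg'⟩ := h (F.comp_proj_mem_algebra g)
    calc g (F.proj x) = g' (G.proj x) := (DFunLike.congr_fun hg' x).symm
      _ = g' (G.proj y) := by rw [hxy]
      _ = g (F.proj y) := DFunLike.congr_fun hg' y
  have isQuotientMap_proj : IsQuotientMap G.proj :=
    .of_surjective_continuous G.surjective G.proj.continuous
  let ρ : C(G.space, F.space) := isQuotientMap_proj.lift F.proj proj_eq_of_proj_eq
  have ρ_proj (x : K) : ρ (G.proj x) = F.proj x :=
    DFunLike.congr_fun (isQuotientMap_proj.lift_comp F.proj proj_eq_of_proj_eq) x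
  refine ⟨ρ, fun y => ?_, ρ_proj⟩
  obtain ⟨x, rfl⟩ := G.surjective y
  rw [← G.equivariant, ρ_proj, ρ_proj, F.equivariant]

theorem nontrivial_space_of_mem_algebra {F : Factor T} {f : C(K, ℂ)} (hf : f ∈ F.algebra)
    (hconst : ¬ ∃ c : ℂ, ∀ x, f x = c) : Nontrivial F.space := by
  obtain ⟨g, rfl⟩ := hf
  by_contra htriv
  have := not_nontrivial_iff_subsingleton.1 htriv
  refine hconst ?_
  rcases isEmpty_or_nonempty K with hK | ⟨⟨x₀⟩⟩
  · exact ⟨0, hK.elim⟩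
  · exact ⟨g (F.proj x₀), fun x => congrArg g (Subsingleton.elim _ _)⟩

theorem exists_mem_algebra_not_const (F : Factor T) [Nontrivial F.space] :
    ∃ f ∈ F.algebra, ¬ ∃ c : ℂ, ∀ x, f x = c := by
  obtain ⟨y, z, hyz⟩ := exists_pair_ne F.space
  obtain ⟨g, hg⟩ : ∃ g : C(F.space, ℂ), g y ≠ g z := by
    by_contra! h
    exact hyz (eq_of_forall_continuousMap_apply_eq h)
  refine ⟨_, F.comp_proj_mem_algebra g, fun ⟨c, hc⟩ => hg ?_⟩
  obtain ⟨y, rfl⟩ := F.surjective y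
  obtain ⟨z, rfl⟩ := F.surjective z
  exact (hc y).trans (hc z).symm

end Factor

section PinskerFactor

variable (T)

/-- The continuous functions of zero entropy, which will turn out to form the Pinsker algebra. -/
abbrev ZeroEntropyFunction : Type u := {f : C(K, ℂ) // observableEntropy T f ≤ 0}

/-- The evaluation map of the zero entropy functions; its image is the space of the
Pinsker factor. -/
noncomputable def zeroEntropyEval : C(K, ZeroEntropyFunction T → ℂ) :=
  ⟨fun x f => f.1 x, by fun_prop⟩

variable [CompactSpace K]

theorem observableEntropy_inducedAut (f : C(K, ℂ)) :
    observableEntropy T (inducedAut T f) = observableEntropy T f :=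
  observableEntropy_comp_of_semiconj T.surjective (fun _ => rfl) f

/-- The change of coordinates `z ↦ (f ↦ z (f ∘ T))`; the evaluation map intertwines it with
`T`. -/
noncomputable def zeroEntropyShift :
    (ZeroEntropyFunction T → ℂ) ≃ₜ (ZeroEntropyFunction T → ℂ) :=
  (Homeomorph.piCongrLeft (Y := fun _ => ℂ) <|
    (inducedAut T).toEquiv.subtypeEquiv fun f => by
      rw [← observableEntropy_inducedAut]; rfl).symm

theorem zeroEntropyShift_eval (x : K) :
    zeroEntropyShift T (zeroEntropyEval T x) = zeroEntropyEval T (T x) := rfl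

theorem zeroEntropyShift_mem_range_iff (z : ZeroEntropyFunction T → ℂ) :
    z ∈ range (zeroEntropyEval T) ↔ zeroEntropyShift T z ∈ range (zeroEntropyEval T) := by
  constructor
  · rintro ⟨x, rfl⟩
    exact ⟨T x, rfl⟩
  · rintro ⟨x, hx⟩
    refine ⟨T.symm x, (zeroEntropyShift T).injective ?_⟩
    rw [zeroEntropyShift_eval, T.apply_symm_apply, hx]

/-- The factor of `(K, T)` generated by the continuous functions of zero entropy. -/
noncomputable def pinskerFactor : Factor T where
  space := range (zeroEntropyEval T)
  compactSpace := isCompact_iff_compactSpace.1 (isCompact_range (zeroEntropyEval T).continuous)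
  homeo := (zeroEntropyShift T).subtype (zeroEntropyShift_mem_range_iff T)
  proj := ⟨rangeFactorization (zeroEntropyEval T),
    (zeroEntropyEval T).continuous.rangeFactorization⟩
  surjective := rangeFactorization_surjective
  equivariant _ := rfl

/-- The coordinate of the Pinsker factor at a zero entropy function. -/
noncomputable def pinskerCoord (f : ZeroEntropyFunction T) : C((pinskerFactor T).space, ℂ) :=
  ⟨fun z : range (zeroEntropyEval T) => z.1 f, (continuous_apply f).comp continuous_subtype_val⟩

theorem mem_algebra_pinskerFactor (f : ZeroEntropyFunction T) :
    f.1 ∈ (pinskerFactor T).algebra :=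
  ⟨pinskerCoord T f, rfl⟩

theorem hasZeroEntropy_pinskerFactor : (pinskerFactor T).HasZeroEntropy := by
  refine (topEntropy_le_zero_iff (g := pinskerCoord T) _ fun y z h =>
    Subtype.ext (funext h)).2 fun f => ?_
  rw [← observableEntropy_comp_of_semiconj (pinskerFactor T).surjective
    (pinskerFactor T).equivariant]
  exact f.2

theorem isPinsker_pinskerFactor : (pinskerFactor T).IsPinsker :=
  ⟨hasZeroEntropy_pinskerFactor T, fun G hG => Factor.isBelow_of_algebra_le fun f hf =>
    mem_algebra_pinskerFactor T ⟨f, G.hasZeroEntropy_iff.1 hG f hf⟩⟩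

variable {T}

theorem Factor.IsPinsker.mem_algebra_iff {F : Factor T} (hF : F.IsPinsker) {f : C(K, ℂ)} :
    f ∈ F.algebra ↔ observableEntropy T f ≤ 0 :=
  ⟨F.hasZeroEntropy_iff.1 hF.1 f, fun hf =>
    (hF.2 _ (hasZeroEntropy_pinskerFactor T)).algebra_le (mem_algebra_pinskerFactor T ⟨f, hf⟩)⟩

theorem hasCompletelyPositiveEntropy_iff :
    HasCompletelyPositiveEntropy T ↔
      ∀ f : C(K, ℂ), (¬ ∃ c : ℂ, ∀ x, f x = c) → 0 < observableEntropy T f := by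
  constructor
  · intro h f hconst
    by_contra! hf
    exact (h _ (Factor.nontrivial_space_of_mem_algebra
      (mem_algebra_pinskerFactor T ⟨f, hf⟩) hconst)).not_ge (hasZeroEntropy_pinskerFactor T)
  · intro h F hnt
    by_contra! hzero
    obtain ⟨f, hf, hconst⟩ := F.exists_mem_algebra_not_const
    exact (h f hconst).not_ge (F.hasZeroEntropy_iff.1 hzero f hf)

end PinskerFactor

theorem topEntropy_pos_iff [CompactSpace K] [T2Space K] :
    0 < topEntropy T ↔ ∃ f : C(K, ℂ), 0 < observableEntropy T f := by
  rw [← not_le, topEntropy_le_zero_iff (g := fun f : C(K, ℂ) => f) T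
    fun _ _ => eq_of_forall_continuousMap_apply_eq, not_forall]
  simp only [not_le]

end Factors

end PinskerL1

theorem theorem5 {K : Type u} [TopologicalSpace K] [CompactSpace K] [T2Space K] (T : K ≃ₜ K) :
    (∃ F : PinskerL1.Factor T, F.IsPinsker) ∧
    (∀ F : PinskerL1.Factor T, F.IsPinsker →
      (F.algebra : Set C(K, ℂ)) = {f | ¬ PinskerL1.HasPosDensityL1Set T f}) ∧
    (0 < PinskerL1.topEntropy T ↔ ∃ f : C(K, ℂ), PinskerL1.HasPosDensityL1Set T f) ∧
    (PinskerL1.HasCompletelyPositiveEntropy T ↔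
      ∀ f : C(K, ℂ), (¬ ∃ c : ℂ, ∀ x, f x = c) → PinskerL1.HasPosDensityL1Set T f) := by
  simp only [PinskerL1.hasPosDensityL1Set_iff, not_lt]
  exact ⟨⟨_, PinskerL1.isPinsker_pinskerFactor T⟩,
    fun F hF => Set.ext fun f => hF.mem_algebra_iff,
    PinskerL1.topEntropy_pos_iff, PinskerL1.hasCompletelyPositiveEntropy_iff⟩
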